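/- Let $X$ be a smooth $n$-dimensional manifold, $\pi:Y\to X$ a smooth (locally trivial) fibre bundle with $m$-dimensional fibres; manifolds are Hausdorff, second countable and $X$, $Y$ are connected. Use fibred coordinates $(x^\lambda,y^i)$, and put $\omega=dx^1\wedge\dots\wedge dx^n$, $\omega_\lambda=\partial_\lambda\rfloor\omega$. Let $J^1Y$ be the first order jet manifold, with coordinates $(x^\lambda,y^i,y^i_\lambda)$, let $\Pi=\wedge^nT^*X\otimes_Y V^*Y\otimes_Y TX$ be the Legendre bundle, with coordinates $(x^\lambda,y^i,p^\lambda_i)$, and let $Z_Y=T^*Y\wedge(\wedge^{n-1}T^*X)\subset\wedge^nT^*Y$. *Lagrangians.* Let $L=\mathcal L\omega:J^1Y\to\wedge^nT^*X$ be a smooth Lagrangian, $\pi^\lambda_i=\partial\mathcal L/\partial y^i_\lambda$, let $\widehat L:J^1Y\to\Pi$, $p^\lambda_i\circ\widehat L=\pi^\lambda_i$, be its Legendre map, $N_L=\widehat L(J^1Y)$ the Lagrangian constraint space, and $H_L=\mathcal L\omega+\pi^\lambda_i(dy^i-y^i_\mu dx^\mu)\wedge\omega_\lambda$ its Poincaré–Cartan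 form, an $n$-form on $J^1Y$. $L$ is called almost regular if (i) for each $q\in N_L$ the preimage $\widehat L^{-1}(q)$ is a connected submanifold of $J^1Y$; (ii) $N_L$ is a closed imbedded subbundle of $\Pi\to Y$; (iii) $\widehat L:J^1Y\to N_L$ is a submersion. *Hamiltonian forms.* A Hamiltonian form is the pull-back $H=p^\lambda_i\,dy^i\wedge\omega_\lambda-\mathcal H\omega$ on $\Pi$ of the canonical $n$-form of $Z_Y$ by a smooth section of $Z_Y\to\Pi$. Its Hamiltonian map is $\widehat H:\Pi\to J^1Y$ (over $Y$), $y^i_\lambda\circ\widehat H=\partial\mathcal H/\partial p^\lambda_i$. $H$ is associated with $L$ if $\widehat L\circ\widehat H\circ\widehat L=\widehat L$ and $H=H_{\widehat H}+\widehat H^*L$, where $H_{\widehat H}=p^\lambda_i\,dy^i\wedge\omega_\lambda-p^\lambda_i(y^i_\lambda\circ\widehat H)\,\omega$. A solution of the Hamilton equations for $H$ is a smooth (possibly local) section $r$ of $\Pi\to X$ such that $\partial_\lambda y^i=\partial\mathcal H/\partial p^\lambda_i$ and $\partial_\lambda p^\lambda_i=-\partial\mathcal H/\partial y^i$ along $r$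 (summation over $\lambda$ in the second equation), in all fibred coordinates. *Constrained Hamilton equations.* Let $L$ be almost regular and suppose that the fibred manifold $\widehat L:J^1Y\to N_L$ has a smooth global section $\Psi$. The constrained Hamiltonian form is the $n$-form $H_N=\Psi^*H_L$ on $N_L$. A solution of the constrained Hamilton equations is a smooth (possibly local) section $r$ of $N_L\to X$ such that $r^*(u_N\rfloor dH_N)=0$ for every smooth vertical vector field $u_N$ on $N_L\to X$. **Theorem.** Let $L$ be an almost regular Lagrangian, $\Psi$ any smooth global section of $\widehat L:J^1Y\to N_L$, $H_N=\Psi^*H_L$, and let $H$ be any Hamiltonian form associated with $L$. If a section $r$ of $\Pi\to X$, over an open set $U\subseteq X$ (for instance $U=X$), is a solution of the Hamilton equations for $H$ and $r(U)\subseteq N_L$, then $r$, regarded as a section of $N_L\to X$ over $U$, is a smooth solution of the constrained Hamilton equations. -/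

import Mathlib

open scoped Manifold ContDiff
open Set Function

noncomputable section
namespace CovHam

universe u v

section General
variable {E E' E'' : Type*} [NormedAddCommGroup E] [NormedSpace ℝ E]
  [NormedAddCommGroup E'] [NormedSpace ℝ E'] [NormedAddCommGroup E''] [NormedSpace ℝ E'']
  {M : Type*} [TopologicalSpace M] [ChartedSpace E M]
  {M' : Type*} [TopologicalSpace M'] [ChartedSpace E' M']
  {M'' : Type*} [TopologicalSpace M''] [ChartedSpace E'' M'']

/-- The tangent map `T_x f : T_x M → T_{f x} M'`; the tangent spaces of a manifold modelled on `E`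
are, as in Mathlib, copies of `E`. -/
def tmap (E E' : Type*) [NormedAddCommGroup E] [NormedSpace ℝ E]
    [NormedAddCommGroup E'] [NormedSpace ℝ E'] {M : Type*} [TopologicalSpace M] [ChartedSpace E M]
    {M' : Type*} [TopologicalSpace M'] [ChartedSpace E' M'] (f : M → M') (x : M) : E →L[ℝ] E' := mfderiv 𝓘(ℝ, E) 𝓘(ℝ, E') f x

/-- `e` is a smooth chart: a diffeomorphism of an open subset of `M` onto an open subset of its model space. -/
structure IsSmoothChart (e : OpenPartialHomeomorph M E) : Prop where
  smooth : ContMDiffOn 𝓘(ℝ, E) 𝓘(ℝ, E) ∞ e e.source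
  smooth_symm : ContMDiffOn 𝓘(ℝ, E) 𝓘(ℝ, E) ∞ e.symm e.target

theorem tmap_comp {g : M' → M''} {f : M → M'} {x : M}
    (hg : MDifferentiableAt 𝓘(ℝ, E') 𝓘(ℝ, E'') g (f x))
    (hf : MDifferentiableAt 𝓘(ℝ, E) 𝓘(ℝ, E') f x) :
    tmap E E'' (g ∘ f) x = (tmap E' E'' g (f x)).comp (tmap E E' f x) :=
  mfderiv_comp x hg hf

theorem tmap_congr {f g : M → M'} {x : M} (h : f =ᶠ[nhds x] g) : tmap E E' f x = tmap E E' g x :=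
  Filter.EventuallyEq.mfderiv_eq h

theorem tmap_eq_fderiv (f : E → E') (x : E) : tmap E E' f x = fderiv ℝ f x := mfderiv_eq_fderiv

theorem tmap_id (x : M) : tmap E E (id : M → M) x = ContinuousLinearMap.id ℝ E := mfderiv_id

namespace IsSmoothChart
variable {e e' : OpenPartialHomeomorph M E}

theorem mdiff (h : IsSmoothChart e) {x : M} (hx : x ∈ e.source) :
    MDifferentiableAt 𝓘(ℝ, E) 𝓘(ℝ, E) e x :=
  ((h.smooth x hx).contMDiffAt (e.open_source.mem_nhds hx)).mdifferentiableAt (by simp)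

theorem mdiff_symm (h : IsSmoothChart e) {z : E} (hz : z ∈ e.target) :
    MDifferentiableAt 𝓘(ℝ, E) 𝓘(ℝ, E) e.symm z :=
  ((h.smooth_symm z hz).contMDiffAt (e.open_target.mem_nhds hz)).mdifferentiableAt (by simp)

theorem tmap_symm_tmap (h : IsSmoothChart e) {x : M} (hx : x ∈ e.source) :
    (tmap E E e.symm (e x)).comp (tmap E E e x) = ContinuousLinearMap.id ℝ E := by
  rw [← tmap_comp (h.mdiff_symm (e.map_source hx)) (h.mdiff hx), ← tmap_id (M := M) x]
  refine tmap_congr ?_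
  filter_upwards [e.open_source.mem_nhds hx] with y hy using e.left_inv hy

theorem tmap_tmap_symm (h : IsSmoothChart e) {z : E} (hz : z ∈ e.target) :
    (tmap E E e (e.symm z)).comp (tmap E E e.symm z) = ContinuousLinearMap.id ℝ E := by
  rw [← tmap_comp (h.mdiff (e.map_target hz)) (h.mdiff_symm hz), ← tmap_id (M := E) z]
  refine tmap_congr ?_
  filter_upwards [e.open_target.mem_nhds hz] with y hy using e.right_inv hy

theorem tmap_trans (h : IsSmoothChart e) (h' : IsSmoothChart e') {z : E}
    (hz : z ∈ (e.symm.trans e').source) :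
    (tmap E E e' (e.symm z)).comp (tmap E E e.symm z) = fderiv ℝ (e.symm.trans e') z := by
  simp only [OpenPartialHomeomorph.trans_source, OpenPartialHomeomorph.symm_source,
    mem_inter_iff, mem_preimage] at hz
  rw [← tmap_comp (h'.mdiff hz.2) (h.mdiff_symm hz.1), tmap_eq_fderiv]
  rfl

theorem contDiffOn_trans (h : IsSmoothChart e) (h' : IsSmoothChart e') :
    ContDiffOn ℝ ∞ (e.symm.trans e') (e.symm.trans e').source := by
  rw [← contMDiffOn_iff_contDiffOn]
  refine h'.smooth.comp (h.smooth_symm.mono ?_) ?_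
  · intro z hz; simp at hz; exact hz.1
  · intro z hz; simp at hz; exact hz.2

theorem contDiffOn_fderiv_trans (h : IsSmoothChart e) (h' : IsSmoothChart e') :
    ContDiffOn ℝ ∞ (fderiv ℝ (e.symm.trans e')) (e.symm.trans e').source :=
  (h.contDiffOn_trans h').fderiv_of_isOpen (e.symm.trans e').open_source (by simp)

end IsSmoothChart

/-- `p : P → B` is a smooth (locally trivial) fibre bundle with `d`-dimensional typical fibre. -/
structure IsSmoothFiberBundle {P : Type u} [TopologicalSpace P] [ChartedSpace E P]
    {B : Type v} [TopologicalSpace B] [ChartedSpace E' B] (d : ℕ) (p : P → B) : Prop where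
  surjective : Function.Surjective p
  locally_trivial : ∃ (F : Type u) (_ : TopologicalSpace F) (_ : ChartedSpace (Fin d → ℝ) F),
    IsManifold 𝓘(ℝ, Fin d → ℝ) ∞ F ∧ ∀ b : B, ∃ e : Bundle.Trivialization F p, b ∈ e.baseSet ∧
      ContMDiffOn 𝓘(ℝ, E) (𝓘(ℝ, E').prod 𝓘(ℝ, Fin d → ℝ)) ∞ e e.source ∧
      ContMDiffOn (𝓘(ℝ, E').prod 𝓘(ℝ, Fin d → ℝ)) 𝓘(ℝ, E) ∞
        e.toOpenPartialHomeomorph.symm e.target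

/-- Differential `k`-forms on `M`. -/
abbrev DForm (E : Type*) [NormedAddCommGroup E] [NormedSpace ℝ E] (M : Type*) (k : ℕ) : Type _ :=
  M → E [⋀^Fin k]→L[ℝ] ℝ

/-- The pull-back `f^*η`. -/
def DForm.pullback {k : ℕ} (f : M → M') (η : DForm E' M' k) : DForm E M k :=
  fun x => (η (f x)).compContinuousLinearMap (tmap E E' f x)

/-- The exterior derivative, computed at `x` in the preferred chart at `x`. -/
def DForm.d {k : ℕ} (η : DForm E M k) : DForm E M (k + 1) := fun x =>
  (extDeriv (DForm.pullback (chartAt E x).symm η) (chartAt E x x)).compContinuousLinearMap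
    (tmap E E (chartAt E x) x)

/-- `S` is an imbedded submanifold of `M`: with its subspace topology it carries a manifold structure
for which the inclusion is a smooth embedding. -/
def IsImbeddedSubmanifold (S : Set M) : Prop :=
  ∃ (d : ℕ) (_ : ChartedSpace (Fin d → ℝ) S), IsManifold 𝓘(ℝ, Fin d → ℝ) ∞ S ∧
    Manifold.IsSmoothEmbedding 𝓘(ℝ, Fin d → ℝ) 𝓘(ℝ, E) ∞ (Subtype.val : S → M)

end General

/-- Model space of the base (dimension `n`) and its tangent spaces. -/
abbrev EX (n : ℕ) : Type := Fin n → ℝ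

/-- Model space of the total space `Y`, with coordinates `(x^λ, y^i)`. -/
abbrev EY (n m : ℕ) : Type := (Fin n → ℝ) × (Fin m → ℝ)

/-- Model space of the jet manifold, with coordinates `(x^λ, y^i, y^i_λ)`. -/
abbrev EJ (n m : ℕ) : Type := EY n m × ((Fin n → ℝ) →L[ℝ] (Fin m → ℝ))

/-- Model space of the Legendre bundle, with coordinates `(x^λ, y^i, p^λ_i)`. -/
abbrev EP (n m : ℕ) : Type := EY n m × (Fin n → Fin m → ℝ)

/-- The vector `∂_λ` of `ℝⁿ`. -/
abbrev dX {n : ℕ} (l : Fin n) : EX n := Pi.single l 1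

/-- The covector `dx^λ` of `ℝⁿ`. -/
abbrev coX {n : ℕ} (l : Fin n) : EX n →L[ℝ] ℝ := ContinuousLinearMap.proj l

/-- The volume form `dx¹ ∧ ⋯ ∧ dxⁿ` of `ℝⁿ`. -/
def vol (n : ℕ) : EX n [⋀^Fin n]→L[ℝ] ℝ :=
  { Matrix.detRowAlternating (R := ℝ) (n := Fin n) with
    cont := by
      change Continuous fun M : Matrix (Fin n) (Fin n) ℝ => M.det
      exact Continuous.matrix_det continuous_id }

theorem vol_apply {n : ℕ} (w : Fin n → EX n) : vol n w = Matrix.det (Matrix.of w) := rfl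

theorem vol_dX {n : ℕ} : vol n (fun l => dX l) = 1 := by
  rw [vol_apply]
  have : (Matrix.of fun l : Fin n => (dX l : EX n)) = 1 := by
    ext i j; simp [dX, Matrix.one_apply, Pi.single_apply, eq_comm]
  rw [this, Matrix.det_one]

theorem eq_smul_vol {n : ℕ} (η : EX n [⋀^Fin n]→L[ℝ] ℝ) : η = η (fun l => dX l) • vol n := by
  have h := AlternatingMap.eq_smul_basis_det (e := Pi.basisFun ℝ (Fin n)) η.toAlternatingMap
  ext w
  have h2 := congrArg (fun f => f w) h
  simp only [Pi.basisFun_det] at h2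
  rw [ContinuousAlternatingMap.smul_apply, vol_apply]
  have h3 : (⇑(Pi.basisFun ℝ (Fin n)) : Fin n → EX n) = fun l => dX l := by
    funext l; simp [Pi.basisFun_apply, dX]
  rw [h3] at h2
  exact h2

section Bundle
variable {n m : ℕ} {X : Type v} [TopologicalSpace X] [ChartedSpace (EX n) X]
  {Y : Type u} [TopologicalSpace Y] [ChartedSpace (EY n m) Y]

/-- A smooth fibre bundle `π : Y → X` over an `n`-dimensional base with `m`-dimensional fibres. -/
structure FieldBundle (n m : ℕ) (X : Type v) [TopologicalSpace X] [ChartedSpace (EX n) X]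
    (Y : Type u) [TopologicalSpace Y] [ChartedSpace (EY n m) Y] where
  proj : Y → X
  isBundle : IsSmoothFiberBundle (E := EY n m) (E' := EX n) m proj

variable (π : FieldBundle n m X Y)

/-- `T_y π : T_y Y → T_{π y} X`. -/
def tproj (y : Y) : EY n m →L[ℝ] EX n := tmap (EY n m) (EX n) π.proj y

/-- The vertical tangent space `V_y Y`. -/
def Vert (y : Y) : Submodule ℝ (EY n m) := LinearMap.ker (tproj π y).toLinearMap

theorem exists_vertProj (y : Y) : ∃ f : EY n m →L[ℝ] Vert π y, ∀ v : Vert π y, f (v : EY n m) = v :=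
  Submodule.ClosedComplemented.of_finiteDimensional (Vert π y)

/-- A linear projection of `T_y Y` onto `V_y Y`; it is only ever applied to vertical vectors, so
that the choice is immaterial. -/
def vertProj (y : Y) : EY n m →L[ℝ] Vert π y := (exists_vertProj π y).choose

theorem vertProj_coe (y : Y) (v : Vert π y) : vertProj π y (v : EY n m) = v :=
  (exists_vertProj π y).choose_spec v

/-- The fibre `J¹_y Y`: linear maps `A : T_{π y} X → T_y Y` with `Tπ ∘ A = id`. -/
@[ext] structure JetFib (y : Y) where
  lin : EX n →L[ℝ] EY n m
  comp_lin : (tproj π y).comp lin = ContinuousLinearMap.id ℝ (EX n)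

/-- The first order jet manifold `J¹Y`. -/
structure Jet where
  base : Y
  fib : JetFib π base

/-- The fibre `Λⁿ T*_x X ⊗ V*_y Y ⊗ T_x X` (`x = π y`) of the Legendre bundle, its elements being
regarded as bilinear maps `V_y Y × T*_x X → Λⁿ T*_x X`. -/
abbrev LegFib (y : Y) : Type :=
  Vert π y →ₗ[ℝ] (EX n →L[ℝ] ℝ) →ₗ[ℝ] (EX n [⋀^Fin n]→L[ℝ] ℝ)

/-- The Legendre bundle `Π`. -/
structure Legendre where
  base : Y
  fib : LegFib π base

/-- Fibred coordinates `(x^λ, y^i)` of `Y → X`: a chart `toTotal` of `Y` over a chart `toBase`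
of `X`. -/
structure FibredChart where
  toBase : OpenPartialHomeomorph X (EX n)
  toTotal : OpenPartialHomeomorph Y (EY n m)
  base_smooth : IsSmoothChart toBase
  total_smooth : IsSmoothChart toTotal
  mapsTo : ∀ y ∈ toTotal.source, π.proj y ∈ toBase.source
  fst_eq : ∀ y ∈ toTotal.source, (toTotal y).1 = toBase (π.proj y)

variable {π}

namespace FibredChart
variable (c c' : FibredChart π)

/-- Differential of the coordinates, `T_y Y → ℝⁿ × ℝᵐ`. -/
def dTot (y : Y) : EY n m →L[ℝ] EY n m := tmap (EY n m) (EY n m) c.toTotal y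

/-- Its inverse `ℝⁿ × ℝᵐ → T_y Y`. -/
def dTotSymm (y : Y) : EY n m →L[ℝ] EY n m :=
  tmap (EY n m) (EY n m) c.toTotal.symm (c.toTotal y)

/-- Differential of the base coordinates, `T_{π y} X → ℝⁿ`. -/
def dBase (y : Y) : EX n →L[ℝ] EX n := tmap (EX n) (EX n) c.toBase (π.proj y)

/-- Its inverse `ℝⁿ → T_{π y} X`. -/
def dBaseSymm (y : Y) : EX n →L[ℝ] EX n :=
  tmap (EX n) (EX n) c.toBase.symm (c.toBase (π.proj y))

variable {c c'} {y : Y}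

theorem dTotSymm_dTot (hy : y ∈ c.toTotal.source) (v : EY n m) :
    c.dTotSymm y (c.dTot y v) = v :=
  congrArg (fun f => f v) (c.total_smooth.tmap_symm_tmap hy)

theorem dTot_dTotSymm (hy : y ∈ c.toTotal.source) (v : EY n m) :
    c.dTot y (c.dTotSymm y v) = v := by
  have h := c.total_smooth.tmap_tmap_symm (c.toTotal.map_source hy)
  rw [c.toTotal.left_inv hy] at h
  exact congrArg (fun f => f v) h

theorem dBaseSymm_dBase (hy : y ∈ c.toTotal.source) (v : EX n) :
    c.dBaseSymm y (c.dBase y v) = v :=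
  congrArg (fun f => f v) (c.base_smooth.tmap_symm_tmap (c.mapsTo y hy))

theorem dBase_dBaseSymm (hy : y ∈ c.toTotal.source) (v : EX n) :
    c.dBase y (c.dBaseSymm y v) = v := by
  have h := c.base_smooth.tmap_tmap_symm (c.toBase.map_source (c.mapsTo y hy))
  rw [c.toBase.left_inv (c.mapsTo y hy)] at h
  exact congrArg (fun f => f v) h

theorem proj_eventuallyEq (hy : y ∈ c.toTotal.source) :
    π.proj =ᶠ[nhds y] c.toBase.symm ∘ (Prod.fst ∘ c.toTotal) := by
  filter_upwards [c.toTotal.open_source.mem_nhds hy] with y' hy'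
  simp [c.fst_eq y' hy', c.toBase.left_inv (c.mapsTo y' hy')]

theorem tproj_eq (hy : y ∈ c.toTotal.source) (v : EY n m) :
    tproj π y v = c.dBaseSymm y (c.dTot y v).1 := by
  have h1 : MDifferentiableAt 𝓘(ℝ, EY n m) 𝓘(ℝ, EX n) (Prod.fst : EY n m → EX n)
      (c.toTotal y) := by
    rw [mdifferentiableAt_iff_differentiableAt]; exact differentiableAt_fst
  have h2 := c.total_smooth.mdiff hy
  have h3 : MDifferentiableAt 𝓘(ℝ, EX n) 𝓘(ℝ, EX n) c.toBase.symm
      ((Prod.fst ∘ c.toTotal) y) := by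
    rw [comp_apply, c.fst_eq y hy]
    exact c.base_smooth.mdiff_symm (c.toBase.map_source (c.mapsTo y hy))
  rw [tproj, tmap_congr (c.proj_eventuallyEq hy), tmap_comp h3 (h1.comp y h2), tmap_comp h1 h2,
    tmap_eq_fderiv, fderiv_fst, comp_apply, c.fst_eq y hy]
  rfl

theorem dBase_tproj (hy : y ∈ c.toTotal.source) (v : EY n m) :
    c.dBase y (tproj π y v) = (c.dTot y v).1 := by
  rw [tproj_eq hy, dBase_dBaseSymm hy]

theorem tproj_dTotSymm (hy : y ∈ c.toTotal.source) (w : EY n m) :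
    tproj π y (c.dTotSymm y w) = c.dBaseSymm y w.1 := by
  rw [tproj_eq hy, dTot_dTotSymm hy]

theorem mem_vert_iff (hy : y ∈ c.toTotal.source) (v : EY n m) :
    v ∈ Vert π y ↔ (c.dTot y v).1 = 0 := by
  rw [Vert, LinearMap.mem_ker, ContinuousLinearMap.coe_coe]
  constructor
  · intro h; rw [← dBase_tproj hy, h, map_zero]
  · intro h; rw [tproj_eq hy, h, map_zero]

theorem dTotSymm_mem_vert (hy : y ∈ c.toTotal.source) (b : Fin m → ℝ) :
    c.dTotSymm y (0, b) ∈ Vert π y := by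
  rw [mem_vert_iff hy, dTot_dTotSymm hy]

variable (c)

/-- The jet at `y` with jet coordinates `y^i_λ = B`. -/
def jetFib (y : Y) (hy : y ∈ c.toTotal.source) (B : EX n →L[ℝ] (Fin m → ℝ)) : JetFib π y where
  lin := (c.dTotSymm y).comp (((ContinuousLinearMap.id ℝ (EX n)).prod B).comp (c.dBase y))
  comp_lin := by
    ext1 v
    simp [tproj_dTotSymm hy, dBaseSymm_dBase hy]

/-- The jet coordinates `y^i_λ` of a jet. -/
def jetCoord {y : Y} (j : JetFib π y) : EX n →L[ℝ] (Fin m → ℝ) :=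
  (ContinuousLinearMap.snd ℝ (EX n) (Fin m → ℝ)).comp
    ((c.dTot y).comp (j.lin.comp (c.dBaseSymm y)))

theorem jetCoord_jetFib (hy : y ∈ c.toTotal.source) (B : EX n →L[ℝ] (Fin m → ℝ)) :
    c.jetCoord (c.jetFib y hy B) = B := by
  ext1 v
  simp [jetCoord, jetFib, dTot_dTotSymm hy, dBase_dBaseSymm hy]

theorem jetFib_jetCoord (hy : y ∈ c.toTotal.source) (j : JetFib π y) :
    c.jetFib y hy (c.jetCoord j) = j := by
  ext1
  ext1 v
  have h1 : c.dTot y (j.lin v) = (c.dBase y v, c.jetCoord j (c.dBase y v)) := by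
    refine Prod.ext ?_ ?_
    · rw [← dBase_tproj hy]
      exact congrArg (fun f => c.dBase y (f v)) j.comp_lin
    · simp [jetCoord, dBaseSymm_dBase hy]
  have h2 : (c.jetFib y hy (c.jetCoord j)).lin v
      = c.dTotSymm y (c.dBase y v, c.jetCoord j (c.dBase y v)) := rfl
  rw [h2, ← h1, dTotSymm_dTot hy]

/-- The momentum coordinates `p^λ_i` of an element of `Π`: it maps `(∂_i, dx^λ)` to
`p^λ_i dx¹ ∧ ⋯ ∧ dxⁿ`. -/
def legCoord {y : Y} (q : LegFib π y) : Fin n → Fin m → ℝ := fun l i =>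
  q (vertProj π y (c.dTotSymm y (0, Pi.single i 1))) ((coX l).comp (c.dBase y))
    (fun k => c.dBaseSymm y (dX k))

/-- The element of `Π` at `y` with momentum coordinates `p^λ_i`. -/
def legFib (y : Y) (p : Fin n → Fin m → ℝ) : LegFib π y :=
  LinearMap.mk₂ ℝ
    (fun v a => (∑ l : Fin n, ∑ i : Fin m,
      p l i * ((c.dTot y (v : EY n m)).2 i * a (c.dBaseSymm y (dX l)))) •
        (vol n).compContinuousLinearMap (c.dBase y))
    (fun v v' a => by
      rw [← add_smul]; simp [← Finset.sum_add_distrib, add_mul, mul_add])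
    (fun r v a => by
      rw [smul_smul]; simp [Finset.mul_sum]; congr 1; simp [mul_left_comm, mul_assoc])
    (fun v a a' => by
      rw [← add_smul]; simp [← Finset.sum_add_distrib, mul_add])
    (fun r v a => by
      rw [smul_smul]; simp [Finset.mul_sum]; congr 1; simp [mul_left_comm])

theorem legFib_apply (y : Y) (p : Fin n → Fin m → ℝ) (v : Vert π y) (a : EX n →L[ℝ] ℝ)
    (w : Fin n → EX n) : c.legFib y p v a w =
      (∑ l : Fin n, ∑ i : Fin m, p l i * ((c.dTot y (v : EY n m)).2 i *
        a (c.dBaseSymm y (dX l)))) * vol n (fun k => c.dBase y (w k)) := by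
  rfl

theorem legCoord_legFib (hy : y ∈ c.toTotal.source) (p : Fin n → Fin m → ℝ) :
    c.legCoord (c.legFib y p) = p := by
  funext l i
  have h := vertProj_coe π y ⟨_, dTotSymm_mem_vert hy (Pi.single i (1 : ℝ))⟩
  simp only at h
  rw [legCoord, h, legFib_apply]
  simp [dTot_dTotSymm hy, dBase_dBaseSymm hy, vol_dX, Pi.single_apply]

theorem form_eq_smul (hy : y ∈ c.toTotal.source) (η : EX n [⋀^Fin n]→L[ℝ] ℝ) :
    η = η (fun k => c.dBaseSymm y (dX k)) • (vol n).compContinuousLinearMap (c.dBase y) := by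
  have h := eq_smul_vol (η.compContinuousLinearMap (c.dBaseSymm y))
  ext w
  have h2 := congrArg (fun f => f (fun k => c.dBase y (w k))) h
  simpa [comp_def, dBaseSymm_dBase hy] using h2

theorem coX_expand (hy : y ∈ c.toTotal.source) (a : EX n →L[ℝ] ℝ) :
    a = ∑ l : Fin n, a (c.dBaseSymm y (dX l)) • (coX l).comp (c.dBase y) := by
  ext1 v
  conv_lhs => rw [← dBaseSymm_dBase hy v, ← Finset.univ_sum_single (c.dBase y v)]
  simp only [map_sum, sum_apply, smul_apply, smul_eq_mul]
  refine Finset.sum_congr rfl fun l _ => ?_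
  have : (Pi.single l (c.dBase y v l) : EX n) = (c.dBase y v l) • dX l := by
    simp [dX, ← Pi.single_smul]
  rw [this]
  simp [mul_comm]

theorem vert_expand (hy : y ∈ c.toTotal.source) (v : Vert π y) :
    v = ∑ i : Fin m, (c.dTot y (v : EY n m)).2 i •
      vertProj π y (c.dTotSymm y (0, Pi.single i 1)) := by
  have h1 : (v : EY n m) = ∑ i : Fin m, (c.dTot y (v : EY n m)).2 i •
      c.dTotSymm y (0, Pi.single i 1) := by
    conv_lhs => rw [← dTotSymm_dTot hy (v : EY n m)]
    simp only [← map_smul, ← map_sum]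
    congr 1
    refine Prod.ext ?_ ?_
    · rw [(mem_vert_iff hy _).1 v.2]; simp [Prod.fst_sum]
    · conv_lhs => rw [← Finset.univ_sum_single (c.dTot y (v : EY n m)).2]
      simp [Prod.snd_sum, ← Pi.single_smul]
  have h2 := congrArg (vertProj π y) h1
  rw [vertProj_coe] at h2
  simpa using h2

theorem legFib_legCoord (hy : y ∈ c.toTotal.source) (q : LegFib π y) :
    c.legFib y (c.legCoord q) = q := by
  refine LinearMap.ext fun v => LinearMap.ext fun a => ?_
  rw [c.form_eq_smul hy (q v a)]
  change (_ : ℝ) • ((vol n).compContinuousLinearMap (c.dBase y)) = _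
  congr 1
  conv_rhs => rw [c.vert_expand hy v, c.coX_expand hy a]
  simp only [map_sum, map_smul, LinearMap.sum_apply, LinearMap.smul_apply,
    ContinuousAlternatingMap.sum_apply, ContinuousAlternatingMap.smul_apply, smul_eq_mul,
    Finset.mul_sum, legCoord]
  refine Finset.sum_congr rfl fun l _ => Finset.sum_congr rfl fun i _ => ?_
  ring

/-! Coordinate charts on `J¹Y` and `Π`. -/

/-- The adapted coordinates `(x^λ, y^i, y^i_λ)` on `J¹Y`; `j₀` is a junk value. -/
def jetChart (j₀ : Jet π) : PartialEquiv (Jet π) (EJ n m) where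
  toFun j := (c.toTotal j.base, c.jetCoord j.fib)
  invFun z := open scoped Classical in
    if h : z.1 ∈ c.toTotal.target then
      ⟨c.toTotal.symm z.1, c.jetFib _ (c.toTotal.map_target h) z.2⟩
    else j₀
  source := {j | j.base ∈ c.toTotal.source}
  target := c.toTotal.target ×ˢ univ
  map_source' j hj := ⟨c.toTotal.map_source hj, mem_univ _⟩
  map_target' z hz := by
    simp only [dif_pos hz.1]; exact c.toTotal.map_target hz.1
  left_inv' j hj := by
    have hj' : c.toTotal j.base ∈ c.toTotal.target := c.toTotal.map_source hj
    simp only [dif_pos hj']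
    obtain ⟨y, f⟩ := j
    change y ∈ c.toTotal.source at hj
    have key : ∀ y' (h' : y' ∈ c.toTotal.source), y' = y →
        (⟨y', c.jetFib y' h' (c.jetCoord f)⟩ : Jet π) = ⟨y, f⟩ := by
      rintro y' h' rfl; rw [c.jetFib_jetCoord]
    exact key _ _ (c.toTotal.left_inv hj)
  right_inv' z hz := by
    have key : ∀ j : Jet π,
        j = ⟨c.toTotal.symm z.1, c.jetFib _ (c.toTotal.map_target hz.1) z.2⟩ →
        (c.toTotal j.base, c.jetCoord j.fib) = z := by
      rintro _ rfl
      exact Prod.ext (c.toTotal.right_inv hz.1) (c.jetCoord_jetFib (c.toTotal.map_target hz.1) _)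
    exact key _ (dif_pos hz.1)

/-- The holonomic coordinates `(x^λ, y^i, p^λ_i)` on `Π`. -/
def legChart : PartialEquiv (Legendre π) (EP n m) where
  toFun q := (c.toTotal q.base, c.legCoord q.fib)
  invFun z := ⟨c.toTotal.symm z.1, c.legFib _ z.2⟩
  source := {q | q.base ∈ c.toTotal.source}
  target := c.toTotal.target ×ˢ univ
  map_source' q hq := ⟨c.toTotal.map_source hq, mem_univ _⟩
  map_target' z hz := c.toTotal.map_target hz.1
  left_inv' q hq := by
    obtain ⟨y, f⟩ := q
    change y ∈ c.toTotal.source at hq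
    have key : ∀ y', y' = y →
        (⟨y', c.legFib y' (c.legCoord f)⟩ : Legendre π) = ⟨y, f⟩ := by
      rintro y' rfl; rw [c.legFib_legCoord hq]
    exact key _ (c.toTotal.left_inv hq)
  right_inv' z hz := by
    simp only [c.legCoord_legFib (c.toTotal.map_target hz.1), c.toTotal.right_inv hz.1]

variable {c}

theorem jetChart_symm_apply {j₀ : Jet π} {z : EJ n m} (hz : z.1 ∈ c.toTotal.target) :
    (c.jetChart j₀).symm z =
      ⟨c.toTotal.symm z.1, c.jetFib _ (c.toTotal.map_target hz) z.2⟩ := dif_pos hz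

theorem toBase_eq (hy : y ∈ c.toTotal.source) : c.toBase.symm (c.toTotal y).1 = π.proj y := by
  rw [c.fst_eq y hy, c.toBase.left_inv (c.mapsTo y hy)]

theorem fst_mem_trans (hy : y ∈ c.toTotal.source) (hy' : y ∈ c'.toTotal.source) :
    (c.toTotal y).1 ∈ (c.toBase.symm.trans c'.toBase).source := by
  simp only [OpenPartialHomeomorph.trans_source, OpenPartialHomeomorph.symm_source,
    mem_inter_iff, mem_preimage]
  rw [toBase_eq hy, c.fst_eq y hy]
  exact ⟨c.toBase.map_source (c.mapsTo y hy), c'.mapsTo y hy'⟩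

theorem mem_trans (hy : y ∈ c.toTotal.source) (hy' : y ∈ c'.toTotal.source) :
    c.toTotal y ∈ (c.toTotal.symm.trans c'.toTotal).source := by
  simp only [OpenPartialHomeomorph.trans_source, OpenPartialHomeomorph.symm_source,
    mem_inter_iff, mem_preimage]
  rw [c.toTotal.left_inv hy]
  exact ⟨c.toTotal.map_source hy, hy'⟩

theorem dTot_comp (hy : y ∈ c.toTotal.source) (hy' : y ∈ c'.toTotal.source) (v : EY n m) :
    c'.dTot y (c.dTotSymm y v) =
      fderiv ℝ (c.toTotal.symm.trans c'.toTotal) (c.toTotal y) v := by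
  rw [← c.total_smooth.tmap_trans c'.total_smooth (mem_trans hy hy'), c.toTotal.left_inv hy]
  rfl

theorem dBase_comp (hy : y ∈ c.toTotal.source) (hy' : y ∈ c'.toTotal.source) (v : EX n) :
    c'.dBase y (c.dBaseSymm y v) =
      fderiv ℝ (c.toBase.symm.trans c'.toBase) (c.toTotal y).1 v := by
  rw [← c.base_smooth.tmap_trans c'.base_smooth (fst_mem_trans hy hy'), toBase_eq hy,
    c.fst_eq y hy]
  rfl

variable (c c')

theorem isOpen_overlap : IsOpen ((c.toTotal.symm.trans c'.toTotal).source) :=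
  (c.toTotal.symm.trans c'.toTotal).open_source

theorem jetChart_trans_source (j₀ : Jet π) :
    ((c.jetChart j₀).symm.trans (c'.jetChart j₀)).source =
      (c.toTotal.symm.trans c'.toTotal).source ×ˢ univ := by
  ext z
  simp only [PartialEquiv.trans_source, PartialEquiv.symm_source, mem_inter_iff, mem_preimage,
    OpenPartialHomeomorph.trans_source, OpenPartialHomeomorph.symm_source, mem_prod, mem_univ,
    and_true]
  constructor
  · rintro ⟨⟨h1, -⟩, h2⟩
    rw [jetChart_symm_apply h1] at h2
    exact ⟨h1, h2⟩
  · rintro ⟨h1, h2⟩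
    refine ⟨⟨h1, mem_univ _⟩, ?_⟩
    rw [jetChart_symm_apply h1]
    exact h2

theorem legChart_trans_source :
    (c.legChart.symm.trans c'.legChart).source =
      (c.toTotal.symm.trans c'.toTotal).source ×ˢ univ := by
  ext z
  simp only [PartialEquiv.trans_source, PartialEquiv.symm_source, mem_inter_iff, mem_preimage,
    OpenPartialHomeomorph.trans_source, OpenPartialHomeomorph.symm_source, mem_prod, mem_univ,
    and_true]
  constructor
  · rintro ⟨⟨h1, -⟩, h2⟩
    exact ⟨h1, h2⟩
  · rintro ⟨h1, h2⟩
    exact ⟨⟨h1, mem_univ _⟩, h2⟩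

/-- Smoothness of the auxiliary coordinate expressions on an overlap of fibred charts. -/
theorem contDiffOn_aux {G : Type*} [NormedAddCommGroup G] [NormedSpace ℝ G] :
    let S := (c.toTotal.symm.trans c'.toTotal).source ×ˢ (univ : Set G)
    let τ := c.toTotal.symm.trans c'.toTotal
    ContDiffOn ℝ ∞ (fun z : EY n m × G => τ z.1) S ∧
    ContDiffOn ℝ ∞ (fun z : EY n m × G => fderiv ℝ τ z.1) S ∧
    ContDiffOn ℝ ∞ (fun z : EY n m × G =>
      fderiv ℝ (c'.toTotal.symm.trans c.toTotal) (τ z.1)) S ∧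
    ContDiffOn ℝ ∞ (fun z : EY n m × G =>
      fderiv ℝ (c.toBase.symm.trans c'.toBase) z.1.1) S ∧
    ContDiffOn ℝ ∞ (fun z : EY n m × G =>
      fderiv ℝ (c'.toBase.symm.trans c.toBase) (τ z.1).1) S := by
  intro S τ
  have hfst : ContDiffOn ℝ ∞ (fun z : EY n m × G => z.1) S := contDiff_fst.contDiffOn
  have hm : MapsTo (fun z : EY n m × G => z.1) S τ.source := fun z hz => hz.1
  have hpt : ∀ z ∈ S, z.1 ∈ c.toTotal.target ∧ c.toTotal.symm z.1 ∈ c'.toTotal.source := by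
    intro z hz
    have := hz.1
    simpa using this
  have hτ : ContDiffOn ℝ ∞ (fun z : EY n m × G => τ z.1) S :=
    (c.total_smooth.contDiffOn_trans c'.total_smooth).comp hfst hm
  refine ⟨hτ, (c.total_smooth.contDiffOn_fderiv_trans c'.total_smooth).comp hfst hm,
    (c'.total_smooth.contDiffOn_fderiv_trans c.total_smooth).comp hτ ?_,
    (c.base_smooth.contDiffOn_fderiv_trans c'.base_smooth).comp
      (contDiff_fst.comp_contDiffOn hfst) ?_,
    (c'.base_smooth.contDiffOn_fderiv_trans c.base_smooth).comp
      (contDiff_fst.comp_contDiffOn hτ) ?_⟩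
  · intro z hz
    exact mem_trans (hpt z hz).2 (c.toTotal.map_target (hpt z hz).1)
  · intro z hz
    have := fst_mem_trans (c.toTotal.map_target (hpt z hz).1) (hpt z hz).2
    rwa [c.toTotal.right_inv (hpt z hz).1] at this
  · intro z hz
    exact fst_mem_trans (hpt z hz).2 (c.toTotal.map_target (hpt z hz).1)

theorem contDiffOn_jetChart_trans (j₀ : Jet π) :
    ContDiffOn ℝ ∞ ((c.jetChart j₀).symm.trans (c'.jetChart j₀))
      ((c.jetChart j₀).symm.trans (c'.jetChart j₀)).source := by
  rw [jetChart_trans_source]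
  obtain ⟨h1, h2, -, -, h5⟩ := contDiffOn_aux c c' (G := EX n →L[ℝ] (Fin m → ℝ))
  have hB : ContDiff ℝ ∞ (fun z : EJ n m => z.2) := contDiff_snd
  have key : ContDiffOn ℝ ∞ (fun z : EJ n m =>
      ((c.toTotal.symm.trans c'.toTotal) z.1,
        (ContinuousLinearMap.snd ℝ (EX n) (Fin m → ℝ)).comp
          ((fderiv ℝ (c.toTotal.symm.trans c'.toTotal) z.1).comp
            (((ContinuousLinearMap.id ℝ (EX n)).prod z.2).comp
              (fderiv ℝ (c'.toBase.symm.trans c.toBase)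
                ((c.toTotal.symm.trans c'.toTotal) z.1).1)))))
      ((c.toTotal.symm.trans c'.toTotal).source ×ˢ univ) := by
    refine h1.prodMk (contDiffOn_const.clm_comp (h2.clm_comp (ContDiffOn.clm_comp ?_ h5)))
    have : (fun z : EJ n m => (ContinuousLinearMap.id ℝ (EX n)).prod z.2) = fun z =>
        (ContinuousLinearMap.inl ℝ (EX n) (Fin m → ℝ)) +
          (ContinuousLinearMap.inr ℝ (EX n) (Fin m → ℝ)).comp z.2 := by
      funext z; ext1 v; simp
    rw [this]
    exact contDiffOn_const.add (contDiffOn_const.clm_comp hB.contDiffOn)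
  refine key.congr ?_
  intro z hz
  have hz1 : z.1 ∈ c.toTotal.target ∧ c.toTotal.symm z.1 ∈ c'.toTotal.source := by
    simpa using hz.1
  have hs := c.toTotal.map_target hz1.1
  rw [PartialEquiv.coe_trans, comp_apply, jetChart_symm_apply hz1.1]
  refine Prod.ext rfl ?_
  ext1 v
  have a1 := dTot_comp hs hz1.2
  have a2 := dBase_comp hz1.2 hs v
  rw [c.toTotal.right_inv hz1.1] at a1
  simp only [ContinuousLinearMap.comp_apply, ContinuousLinearMap.coe_snd',
    ContinuousLinearMap.prod_apply, ContinuousLinearMap.id_apply]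
  rw [← a1]
  change (c'.dTot _ (c.dTotSymm _ (c.dBase _ (c'.dBaseSymm _ v),
    z.2 (c.dBase _ (c'.dBaseSymm _ v))))).2 = _
  rw [a2]
  rfl

theorem contDiffOn_legChart_trans :
    ContDiffOn ℝ ∞ (c.legChart.symm.trans c'.legChart)
      (c.legChart.symm.trans c'.legChart).source := by
  rw [legChart_trans_source]
  obtain ⟨h1, h2, h3, h4, h5⟩ := contDiffOn_aux c c' (G := Fin n → Fin m → ℝ)
  set S := (c.toTotal.symm.trans c'.toTotal).source ×ˢ (univ : Set (Fin n → Fin m → ℝ))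
  set τ := c.toTotal.symm.trans c'.toTotal
  have key : ContDiffOn ℝ ∞ (fun z : EP n m =>
      ((τ z.1, fun l i =>
        (∑ μ : Fin n, ∑ j : Fin m, z.2 μ j *
          ((fderiv ℝ (c'.toTotal.symm.trans c.toTotal) (τ z.1) (0, Pi.single i 1)).2 j *
            fderiv ℝ (c.toBase.symm.trans c'.toBase) z.1.1 (dX μ) l)) *
        vol n (fun k => fderiv ℝ (c'.toBase.symm.trans c.toBase) (τ z.1).1 (dX k))) : EP n m)) S := by
    refine h1.prodMk ?_
    rw [contDiffOn_pi]; intro l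
    rw [contDiffOn_pi]; intro i
    refine ContDiffOn.mul (ContDiffOn.sum fun μ _ => ContDiffOn.sum fun j _ => ?_) ?_
    · refine ContDiffOn.mul ?_ (ContDiffOn.mul ?_ ?_)
      · have : ContDiff ℝ ∞ (fun z : EP n m => z.2 μ j) := by fun_prop
        exact this.contDiffOn
      · have := h3.clm_apply (contDiffOn_const (c := ((0, Pi.single i 1) : EY n m)))
        have h := contDiff_snd.comp_contDiffOn this
        exact (contDiffOn_pi.1 h) j
      · have := h4.clm_apply (contDiffOn_const (c := (dX μ : EX n)))
        exact (contDiffOn_pi.1 this) l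
    · exact (vol n).toContinuousMultilinearMap.contDiff.comp_contDiffOn
        (contDiffOn_pi.2 fun k => h5.clm_apply contDiffOn_const)
  refine key.congr ?_
  intro z hz
  have hz1 : z.1 ∈ c.toTotal.target ∧ c.toTotal.symm z.1 ∈ c'.toTotal.source := by
    simpa using hz.1
  have hs := c.toTotal.map_target hz1.1
  refine Prod.ext rfl ?_
  funext l i
  have h := vertProj_coe π _ ⟨_, dTotSymm_mem_vert hz1.2 (Pi.single i (1 : ℝ))⟩
  simp only at h
  change c'.legCoord (c.legFib _ z.2) l i = _
  rw [legCoord, h, legFib_apply]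
  simp only [ContinuousLinearMap.comp_apply, dBase_comp hs hz1.2, dBase_comp hz1.2 hs,
    dTot_comp hz1.2 hs, c.toTotal.right_inv hz1.1]
  rfl

end FibredChart

open FibredChart

variable [IsManifold 𝓘(ℝ, EX n) ∞ X]

theorem exists_fibredChart (π : FieldBundle n m X Y) (y : Y) :
    ∃ c : FibredChart π, y ∈ c.toTotal.source := by
  obtain ⟨F, i1, i2, hF, h⟩ := π.isBundle.locally_trivial
  obtain ⟨e, hb, he, he'⟩ := h (π.proj y)
  have hy : y ∈ e.source := e.mem_source.2 hb
  let φ := chartAt (EX n) (π.proj y)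
  let χ := chartAt (Fin m → ℝ) (e y).2
  have hφ : ContMDiffOn 𝓘(ℝ, EX n) 𝓘(ℝ, EX n) ∞ φ φ.source := contMDiffOn_chart
  have hχ : ContMDiffOn 𝓘(ℝ, Fin m → ℝ) 𝓘(ℝ, Fin m → ℝ) ∞ χ χ.source := contMDiffOn_chart
  have hφ' : ContMDiffOn 𝓘(ℝ, EX n) 𝓘(ℝ, EX n) ∞ φ.symm φ.target := contMDiffOn_chart_symm
  have hχ' : ContMDiffOn 𝓘(ℝ, Fin m → ℝ) 𝓘(ℝ, Fin m → ℝ) ∞ χ.symm χ.target :=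
    contMDiffOn_chart_symm
  let ψ : OpenPartialHomeomorph Y (EY n m) := e.toOpenPartialHomeomorph.trans (φ.prod χ)
  have hsrc : ∀ z ∈ ψ.source, z ∈ e.source ∧ (e z).1 ∈ φ.source ∧ (e z).2 ∈ χ.source := by
    intro z hz
    have : z ∈ e.source ∧ e z ∈ φ.source ×ˢ χ.source := by simpa [ψ] using hz
    exact ⟨this.1, this.2.1, this.2.2⟩
  have htgt : ∀ z ∈ ψ.target, z.1 ∈ φ.target ∧ z.2 ∈ χ.target ∧
      (φ.symm z.1, χ.symm z.2) ∈ e.target := by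
    intro z hz
    have : z ∈ φ.target ×ˢ χ.target ∧ (φ.prod χ).symm z ∈ e.target := hz
    exact ⟨this.1.1, this.1.2, this.2⟩
  refine ⟨⟨φ, ψ, ⟨hφ, hφ'⟩, ⟨?_, ?_⟩, ?_, ?_⟩, ?_⟩
  · have h1 : ContMDiffOn 𝓘(ℝ, EY n m) 𝓘(ℝ, EX n) ∞ (fun z => φ (e z).1) ψ.source :=
      hφ.comp ((contMDiff_fst (I := 𝓘(ℝ, EX n)) (J := 𝓘(ℝ, Fin m → ℝ))).comp_contMDiffOn
        (he.mono fun z hz => (hsrc z hz).1)) fun z hz => (hsrc z hz).2.1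
    have h2 : ContMDiffOn 𝓘(ℝ, EY n m) 𝓘(ℝ, Fin m → ℝ) ∞ (fun z => χ (e z).2) ψ.source :=
      hχ.comp ((contMDiff_snd (I := 𝓘(ℝ, EX n)) (J := 𝓘(ℝ, Fin m → ℝ))).comp_contMDiffOn
        (he.mono fun z hz => (hsrc z hz).1)) fun z hz => (hsrc z hz).2.2
    exact h1.prodMk_space h2
  · have h1 : ContMDiffOn 𝓘(ℝ, EY n m) 𝓘(ℝ, EX n) ∞ (fun z => φ.symm z.1) ψ.target :=
      hφ'.comp contDiff_fst.contMDiff.contMDiffOn fun z hz => (htgt z hz).1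
    have h2 : ContMDiffOn 𝓘(ℝ, EY n m) 𝓘(ℝ, Fin m → ℝ) ∞ (fun z => χ.symm z.2) ψ.target :=
      hχ'.comp contDiff_snd.contMDiff.contMDiffOn fun z hz => (htgt z hz).2.1
    exact he'.comp (h1.prodMk h2) fun z hz => (htgt z hz).2.2
  · intro z hz
    rw [← e.coe_fst (hsrc z hz).1]
    exact (hsrc z hz).2.1
  · intro z hz
    change φ (e z).1 = φ (π.proj z)
    rw [e.coe_fst (hsrc z hz).1]
  · have : y ∈ e.source ∧ e y ∈ φ.source ×ˢ χ.source :=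
      ⟨hy, by rw [e.coe_fst hy]; exact mem_chart_source _ _, mem_chart_source _ _⟩
    simpa [ψ] using this

/-- A fibred chart around `y`. -/
def fibredChartAt (π : FieldBundle n m X Y) (y : Y) : FibredChart π :=
  (exists_fibredChart π y).choose

theorem mem_fibredChartAt (π : FieldBundle n m X Y) (y : Y) :
    y ∈ (fibredChartAt π y).toTotal.source :=
  (exists_fibredChart π y).choose_spec

instance [Nonempty Y] : Nonempty (Jet π) :=
  let y : Y := Classical.arbitrary Y
  ⟨⟨y, (fibredChartAt π y).jetFib y (mem_fibredChartAt π y) 0⟩⟩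

/-- The manifold structure of `J¹Y`: the charts are the adapted coordinates. -/
def jetCore [Nonempty Y] (π : FieldBundle n m X Y) : ChartedSpaceCore (EJ n m) (Jet π) where
  atlas := range fun c : FibredChart π => c.jetChart (Classical.arbitrary _)
  chartAt j := (fibredChartAt π j.base).jetChart (Classical.arbitrary _)
  mem_chart_source j := mem_fibredChartAt π j.base
  chart_mem_atlas j := mem_range_self _
  open_source := by
    rintro _ _ ⟨c, rfl⟩ ⟨c', rfl⟩
    rw [jetChart_trans_source]
    exact (isOpen_overlap c c').prod isOpen_univ
  continuousOn_toFun := by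
    rintro _ _ ⟨c, rfl⟩ ⟨c', rfl⟩
    exact (contDiffOn_jetChart_trans c c' _).continuousOn

instance [Nonempty Y] : TopologicalSpace (Jet π) := (jetCore π).toTopologicalSpace

instance [Nonempty Y] : ChartedSpace (EJ n m) (Jet π) := (jetCore π).toChartedSpace

instance [Nonempty Y] : IsManifold 𝓘(ℝ, EJ n m) ∞ (Jet π) := by
  refine isManifold_of_contDiffOn _ _ _ ?_
  intro e e' he he'
  obtain ⟨_, ⟨_, rfl⟩, _, ⟨⟨c, rfl⟩, rfl⟩, he⟩ := he
  obtain ⟨_, ⟨_, rfl⟩, _, ⟨⟨c', rfl⟩, rfl⟩, he'⟩ := he'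
  rw [mem_singleton_iff] at he he'
  subst he he'
  have h := contDiffOn_jetChart_trans c c' (Classical.arbitrary (Jet π))
  simp only [modelWithCornersSelf_coe, modelWithCornersSelf_coe_symm, range_id, inter_univ,
    preimage_id, CompTriple.comp_eq]
  exact h

/-- The manifold structure of `Π`: the charts are the holonomic coordinates. -/
def legCore (π : FieldBundle n m X Y) : ChartedSpaceCore (EP n m) (Legendre π) where
  atlas := range fun c : FibredChart π => c.legChart
  chartAt q := (fibredChartAt π q.base).legChart
  mem_chart_source q := mem_fibredChartAt π q.base
  chart_mem_atlas q := mem_range_self _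
  open_source := by
    rintro _ _ ⟨c, rfl⟩ ⟨c', rfl⟩
    rw [legChart_trans_source]
    exact (isOpen_overlap c c').prod isOpen_univ
  continuousOn_toFun := by
    rintro _ _ ⟨c, rfl⟩ ⟨c', rfl⟩
    exact (contDiffOn_legChart_trans c c').continuousOn

instance : TopologicalSpace (Legendre π) := (legCore π).toTopologicalSpace

instance : ChartedSpace (EP n m) (Legendre π) := (legCore π).toChartedSpace

instance : IsManifold 𝓘(ℝ, EP n m) ∞ (Legendre π) := by
  refine isManifold_of_contDiffOn _ _ _ ?_
  intro e e' he he'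
  obtain ⟨_, ⟨_, rfl⟩, _, ⟨⟨c, rfl⟩, rfl⟩, he⟩ := he
  obtain ⟨_, ⟨_, rfl⟩, _, ⟨⟨c', rfl⟩, rfl⟩, he'⟩ := he'
  rw [mem_singleton_iff] at he he'
  subst he he'
  have h := contDiffOn_legChart_trans c c'
  simp only [modelWithCornersSelf_coe, modelWithCornersSelf_coe_symm, range_id, inter_univ,
    preimage_id, CompTriple.comp_eq]
  exact h

variable [Nonempty Y]

/-- A Lagrangian `L = 𝓛 ω : J¹Y → Λⁿ T*X`, a bundle map over `X` with smooth coefficients `𝓛`. -/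
structure Lagrangian (π : FieldBundle n m X Y) where
  toFun : Jet π → EX n [⋀^Fin n]→L[ℝ] ℝ
  smooth : ∀ c : FibredChart π, ContMDiffOn 𝓘(ℝ, EJ n m) 𝓘(ℝ, ℝ) ∞
    (fun j => toFun j fun k => c.dBaseSymm j.base (dX k)) {j | j.base ∈ c.toTotal.source}

/-- `J¹_y Y` is an affine space over `Hom(T_x X, V_y Y)`. -/
def JetFib.add {y : Y} (j : JetFib π y) (b : EX n →L[ℝ] Vert π y) : JetFib π y where
  lin := j.lin + (Vert π y).subtypeL.comp b
  comp_lin := by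
    ext1 v
    have h1 := congrArg (fun f => f v) j.comp_lin
    have h2 : tproj π y (b v : EY n m) = 0 := (b v).2
    simpa [h2] using h1

/-- The Legendre map `L̂ : J¹Y → Π`, the fibre derivative of `L`; in coordinates
`p^λ_i = ∂𝓛/∂y^i_λ`. -/
def legendreMap (L : Lagrangian π) (j : Jet π) : Legendre π where
  base := j.base
  fib :=
    let D := fderiv ℝ (fun b : EX n →L[ℝ] Vert π j.base => L.toFun ⟨j.base, j.fib.add b⟩) 0
    LinearMap.mk₂ ℝ (fun v a => D (a.smulRight v))
      (fun v v' a => by rw [← map_add]; congr 1; ext1 w; simp)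
      (fun t v a => by
        rw [← map_smul]; congr 1; ext1 w
        simp only [ContinuousLinearMap.smulRight_apply, smul_apply]
        exact smul_comm _ _ _)
      (fun v a a' => by rw [← map_add]; congr 1; ext1 w; simp [add_smul])
      (fun t v a => by rw [← map_smul]; congr 1; ext1 w; simp [mul_smul])

/-- The vertical part `v - A (Tπ v)` of a tangent vector with respect to a jet `A`; in coordinates
it has the components `dy^i - y^i_λ dx^λ`. -/
def JetFib.vertPart {y : Y} (j : JetFib π y) : EY n m →L[ℝ] Vert π y :=
  (ContinuousLinearMap.id ℝ (EY n m) - j.lin.comp (tproj π y)).codRestrict (Vert π y) fun v => by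
    have h1 := congrArg (fun f => f (tproj π y v)) j.comp_lin
    change tproj π y (v - j.lin (tproj π y v)) = 0
    simp only [ContinuousLinearMap.comp_apply, ContinuousLinearMap.id_apply] at h1
    rw [map_sub, h1, sub_self]

/-- The 1-form `p^λ_i (dy^i - y^i_μ dx^μ)` on `T_y Y`, for fixed `λ`. -/
def momentumCovector {y : Y} (q : LegFib π y) (j : JetFib π y) (l : Fin n) : EY n m →L[ℝ] ℝ :=
  LinearMap.toContinuousLinearMap
    { toFun := fun w => q (j.vertPart w) (coX l) fun k => dX k
      map_add' := fun v w => by simp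
      map_smul' := fun t v => by rw [map_smul, map_smul]; rfl }

/-- The `n`-form `p^λ_i (dy^i - y^i_μ dx^μ) ∧ ω_λ` on `T_y Y`, where `ω_λ = ∂_λ ⌟ ω`. As
`θ ∧ ω_λ` is `dx¹ ∧ ⋯ ∧ dxⁿ` with the factor `dx^λ` replaced by `θ`, it is the sum over `λ` of
`dx¹ ∧ ⋯ ∧ dxⁿ` with `dx^λ` replaced by `p^λ_i (dy^i - y^i_μ dx^μ)`. -/
def momentumForm {y : Y} (q : LegFib π y) (j : JetFib π y) : EY n m [⋀^Fin n]→L[ℝ] ℝ :=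
  ∑ l : Fin n, (vol n).compContinuousLinearMap (ContinuousLinearMap.pi fun k =>
    if k = l then momentumCovector q j l else (coX k).comp (tproj π y))

/-- The Poincaré–Cartan form `H_L = 𝓛 ω + π^λ_i (dy^i - y^i_μ dx^μ) ∧ ω_λ` on `J¹Y`,
`π^λ_i = ∂𝓛/∂y^i_λ`. -/
def poincareCartan (L : Lagrangian π) : DForm (EJ n m) (Jet π) n := fun j =>
  ((L.toFun j).compContinuousLinearMap (tproj π j.base)
    + momentumForm (legendreMap L j).fib j.fib).compContinuousLinearMap
      (tmap (EJ n m) (EY n m) (Jet.base : Jet π → Y) j)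

/-- A Hamiltonian form `H = p^λ_i dy^i ∧ ω_λ - 𝓗 ω` on `Π`, i.e. the pull-back of the canonical
form of `Z_Y = T*Y ∧ Λⁿ⁻¹T*X ⊆ Λⁿ T*Y` along a smooth section of `Z_Y → Π`. It is given by that
section, `toFun q ∈ Λⁿ T*_y Y` for `q` over `y`. An element `z` of `Λⁿ T*_y Y` belongs to `Z_Y` and
projects to `q` iff `v ⌟ z = p^λ_i v^i ω_λ` for all vertical `v`, where `p^λ_i` are the momenta
of `q`. -/
structure HamiltonianForm (π : FieldBundle n m X Y) where
  toFun : Legendre π → EY n m [⋀^Fin n]→L[ℝ] ℝ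
  isSection : ∀ (q : Legendre π) (v : Vert π q.base) (w : Fin n → EY n m) (k : Fin n),
    toFun q (update w k (v : EY n m)) =
      ∑ l : Fin n, q.fib v (coX l) (update (fun i => tproj π q.base (w i)) k (dX l))
  smooth : ∀ c : FibredChart π, ContMDiffOn 𝓘(ℝ, EP n m) 𝓘(ℝ, ℝ) ∞
    (fun q => - toFun q fun k => c.dTotSymm q.base (dX k, 0)) {q | q.base ∈ c.toTotal.source}

namespace HamiltonianForm
variable (H : HamiltonianForm π) (c : FibredChart π)

/-- The Hamiltonian `𝓗(x, y, p)` in a fibred chart: `-𝓗` is the coefficient of `ω` in `H`. -/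
def ham (z : EP n m) : ℝ :=
  - H.toFun (c.legChart.symm z) fun k => c.dTotSymm (c.legChart.symm z).base (dX k, 0)

/-- `∂𝓗/∂y^i` at `q ∈ Π`. -/
def dHdy (q : Legendre π) (i : Fin m) : ℝ :=
  fderiv ℝ (H.ham c) (c.legChart q) ((0, Pi.single i 1), 0)

/-- `∂𝓗/∂p^λ_i` at `q ∈ Π`. -/
def dHdp (q : Legendre π) (l : Fin n) (i : Fin m) : ℝ :=
  fderiv ℝ (H.ham c) (c.legChart q) (0, Pi.single l (Pi.single i 1))

/-- The Hamiltonian map `Ĥ : Π → J¹Y` over `Y`, `y^i_λ = ∂𝓗/∂p^λ_i`. (The jet does not depend on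
the fibred chart used.) -/
def mapFib (q : Legendre π) : JetFib π q.base :=
  (fibredChartAt π q.base).jetFib q.base (mem_fibredChartAt π q.base)
    (ContinuousLinearMap.pi fun i =>
      ∑ l : Fin n, H.dHdp (fibredChartAt π q.base) q l i • coX l)

/-- The Hamiltonian map as a map `Π → J¹Y`. -/
def map (q : Legendre π) : Jet π := ⟨q.base, H.mapFib q⟩

/-- `H` is associated with `L`: `L̂ ∘ Ĥ ∘ L̂ = L̂` and `H = H_Ĥ + Ĥ^* L`, where
`H_Ĥ = p^λ_i dy^i ∧ ω_λ - p^λ_i (y^i_λ ∘ Ĥ) ω`. -/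
structure IsAssociated (L : Lagrangian π) : Prop where
  legendre : ∀ j : Jet π, legendreMap L (H.map (legendreMap L j)) = legendreMap L j
  form : ∀ q : Legendre π, H.toFun q = momentumForm q.fib (H.mapFib q)
    + (L.toFun (H.map q)).compContinuousLinearMap (tproj π q.base)

/-- `r` is, on the open set `U`, a smooth section of `Π → X` which solves the Hamilton equations
`∂_λ y^i = ∂𝓗/∂p^λ_i`, `∂_λ p^λ_i = -∂𝓗/∂y^i`. -/
structure IsSolution (U : Set X) (r : X → Legendre π) : Prop where
  smooth : ContMDiffOn 𝓘(ℝ, EX n) 𝓘(ℝ, EP n m) ∞ r U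
  isSection : ∀ x ∈ U, π.proj (r x).base = x
  eq_y : ∀ c : FibredChart π, ∀ x ∈ U, (r x).base ∈ c.toTotal.source → ∀ l i,
    (fderiv ℝ (fun ξ => c.legChart (r (c.toBase.symm ξ))) (c.toBase x) (dX l)).1.2 i
      = H.dHdp c (r x) l i
  eq_p : ∀ c : FibredChart π, ∀ x ∈ U, (r x).base ∈ c.toTotal.source → ∀ i,
    ∑ l : Fin n, (fderiv ℝ (fun ξ => c.legChart (r (c.toBase.symm ξ))) (c.toBase x) (dX l)).2 l i
      = - H.dHdy c (r x) i

end HamiltonianForm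

/-- The Lagrangian constraint space `N_L = L̂(J¹Y) ⊆ Π`. -/
def constraintSpace (L : Lagrangian π) : Set (Legendre π) := range (legendreMap L)

/-- `L̂ : J¹Y → N_L`. -/
def toConstraint (L : Lagrangian π) (j : Jet π) : constraintSpace L :=
  ⟨legendreMap L j, mem_range_self j⟩

/-- `L` is semiregular: the preimages `L̂⁻¹(q)`, `q ∈ N_L`, are connected submanifolds. -/
def IsSemiregular (L : Lagrangian π) : Prop :=
  ∀ q ∈ constraintSpace L, IsConnected (legendreMap L ⁻¹' {q}) ∧
    IsImbeddedSubmanifold (E := EJ n m) (legendreMap L ⁻¹' {q})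

section Constraint
variable (k : ℕ) (L : Lagrangian π) [ChartedSpace (Fin k → ℝ) (constraintSpace L)]

/-- `L` is almost regular, with respect to a manifold structure of the subspace `N_L` of `Π`. -/
structure IsAlmostRegular : Prop where
  semiregular : IsSemiregular L
  isClosed : IsClosed (constraintSpace L)
  imbedded : Manifold.IsSmoothEmbedding 𝓘(ℝ, Fin k → ℝ) 𝓘(ℝ, EP n m) ∞
    (Subtype.val : constraintSpace L → Legendre π)
  subbundle : ∃ d : ℕ, IsSmoothFiberBundle (E := Fin k → ℝ) (E' := EY n m) d
    fun q : constraintSpace L => q.1.base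
  submersion : ∀ j : Jet π, Manifold.IsSubmersionAt 𝓘(ℝ, EJ n m) 𝓘(ℝ, Fin k → ℝ) ∞
    (toConstraint L) j

/-- `Ψ` is a global section of the fibred manifold `L̂ : J¹Y → N_L`. -/
structure IsLegendreSection (Ψ : constraintSpace L → Jet π) : Prop where
  smooth : ContMDiff 𝓘(ℝ, Fin k → ℝ) 𝓘(ℝ, EJ n m) ∞ Ψ
  isSection : ∀ q, toConstraint L (Ψ q) = q

/-- The constrained Hamiltonian form `H_N = Ψ^* H_L` on `N_L`. -/
def constrainedForm (Ψ : constraintSpace L → Jet π) :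
    DForm (Fin k → ℝ) (constraintSpace L) n :=
  DForm.pullback Ψ (poincareCartan L)

/-- `s` is, on the open set `U`, a smooth section of `N_L → X` which solves the constrained
Hamilton equations `s^*(u ⌟ dH_N) = 0` for all smooth vertical vector fields `u` on `N_L → X`. -/
structure IsConstrainedSolution [IsManifold 𝓘(ℝ, Fin k → ℝ) ∞ (constraintSpace L)]
    (Ψ : constraintSpace L → Jet π) (U : Set X) (s : X → constraintSpace L) : Prop where
  smooth : ContMDiffOn 𝓘(ℝ, EX n) 𝓘(ℝ, Fin k → ℝ) ∞ s U
  isSection : ∀ x ∈ U, π.proj (s x).1.base = x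
  eq_zero : ∀ u : (q : constraintSpace L) → TangentSpace 𝓘(ℝ, Fin k → ℝ) q,
    ContMDiff 𝓘(ℝ, Fin k → ℝ) 𝓘(ℝ, Fin k → ℝ).tangent ∞
      (fun q => (⟨q, u q⟩ : TangentBundle 𝓘(ℝ, Fin k → ℝ) (constraintSpace L))) →
    (∀ q, tmap (Fin k → ℝ) (EX n) (fun q : constraintSpace L => π.proj q.1.base) q (u q) = 0) →
    ∀ x ∈ U, ∀ w : Fin n → EX n,
      (constrainedForm k L Ψ).d (s x)
        (Fin.cons (u (s x)) fun i => tmap (EX n) (Fin k → ℝ) s x (w i)) = 0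

end Constraint

end Bundle

end CovHam

end

open CovHam

/-!
Both the Poincaré–Cartan form `H_L` and a Hamiltonian form take values that come from `Λⁿ T*Y`, so
everything reduces to one algebraic identity and one computation in coordinates.

*The identity* `H_N = i^*H`, where `i : N_L → Π` is the inclusion. Along the affine fibre of `J¹Y` over
`y`, the form `𝓛 ω + p^λ_i (dy^i - y^i_μ dx^μ) ∧ ω_λ` with fixed momenta `p` varies as the function
`𝓛 - p^λ_i y^i_λ`, whose derivative `π^λ_i - p^λ_i` vanishes at the jets with Legendre momentum `p`. As
the preimage `L̂⁻¹(q)` is a connected submanifold, the form is constant on it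
(`cartanForm_eq_of_legendreMap_eq`). Both `Ψ q` and `Ĥ q` lie in `L̂⁻¹(q)`, and at `Ĥ q` the form is
`H(q)` because `H` is associated with `L` (`cartanForm_eq_hamiltonianForm`). Hence `Ψ^*H_L` is the
restriction of `H` to `N_L` (`constrainedForm_eq`), and in fibred coordinates `dH_N` is the pull-back of
`d(p^λ_i dy^i ∧ ω_λ - 𝓗 ω)` (`HamiltonianForm.toFun_eq_coordForm`, `d_constrainedForm`).

*The computation.* For tangent vectors of a section satisfying the Hamilton equations and a vertical
vector `v = (a^i, b^λ_i)`, the contraction of `dH` is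
`b^λ_i (∂_λ y^i - ∂𝓗/∂p^λ_i) - a^i (∂_λ p^λ_i + ∂𝓗/∂y^i) = 0` times `ω`
(`extDeriv_coordDForm_eq_zero`). A vertical vector field on `N_L` is such a vertical vector of `Π`, which
gives the theorem.
-/

noncomputable section
namespace CovHam
universe u v

/-! ### Forms `θ ∧ ω_λ` -/

section SubForm
variable {n : ℕ} {F G : Type*} [NormedAddCommGroup F] [NormedSpace ℝ F]
  [NormedAddCommGroup G] [NormedSpace ℝ G]

/-- For `T : F → ℝⁿ` and a covector `θ` of `F`, the `n`-form `θ ∧ T^*ω_l`, where `ω_l = ∂_l ⌟ ω`: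
the pull-back of `dx¹ ∧ ⋯ ∧ dxⁿ` along `T` with the factor `dx^l` replaced by `θ`. -/
def subForm (T : F →L[ℝ] EX n) (l : Fin n) (θ : F →L[ℝ] ℝ) : F [⋀^Fin n]→L[ℝ] ℝ :=
  (vol n).compContinuousLinearMap
    (ContinuousLinearMap.pi fun k => if k = l then θ else (coX k).comp T)

theorem subForm_apply (T : F →L[ℝ] EX n) (l : Fin n) (θ : F →L[ℝ] ℝ) (w : Fin n → F) :
    subForm T l θ w = ((Matrix.of fun i => T (w i)).updateCol l fun i => θ (w i)).det := by
  change Matrix.det _ = _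
  congr 1
  ext i k
  by_cases h : k = l
  · subst h; simp
  · simp [h]

theorem subForm_add (T : F →L[ℝ] EX n) (l : Fin n) (θ θ' : F →L[ℝ] ℝ) :
    subForm T l (θ + θ') = subForm T l θ + subForm T l θ' := by
  ext w
  simp only [subForm_apply, ContinuousAlternatingMap.add_apply]
  exact Matrix.det_updateCol_add _ _ _ _

theorem subForm_sub (T : F →L[ℝ] EX n) (l : Fin n) (θ θ' : F →L[ℝ] ℝ) :
    subForm T l (θ - θ') = subForm T l θ - subForm T l θ' := by
  rw [eq_sub_iff_add_eq, ← subForm_add, sub_add_cancel]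

theorem subForm_comp (T : G →L[ℝ] EX n) (l : Fin n) (θ : G →L[ℝ] ℝ) (A : F →L[ℝ] G) :
    subForm (T.comp A) l (θ.comp A) = (subForm T l θ).compContinuousLinearMap A := by
  ext w
  simp [subForm_apply, Function.comp_def]

theorem subForm_apply_of_eq (T : F →L[ℝ] EX n) (l : Fin n) (θ : F →L[ℝ] ℝ) {w : Fin n → F}
    (hw : ∀ i, T (w i) = dX i) : subForm T l θ w = θ (w l) := by
  have h : (Matrix.of fun i => T (w i)) = 1 := by
    ext i j; simp [hw, Matrix.one_apply, Pi.single_apply, eq_comm]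
  rw [subForm_apply, h, ← Matrix.cramer_apply, Matrix.cramer_one]
  rfl

theorem subForm_id (l : Fin n) (μ : EX n →L[ℝ] ℝ) :
    subForm (ContinuousLinearMap.id ℝ (EX n)) l μ = μ (dX l) • vol n := by
  rw [eq_smul_vol (subForm _ l μ), subForm_apply_of_eq _ _ _ fun _ => rfl]

/-- If one of the arguments `v` is annihilated by `T`, then only the factor `θ` can absorb it. -/
theorem subForm_update (T : F →L[ℝ] EX n) (l : Fin n) (θ : F →L[ℝ] ℝ) (w : Fin n → F) (k : Fin n)
    {v : F} (hv : T v = 0) :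
    subForm T l θ (update w k v) = θ v * vol n (update (fun i => T (w i)) k (dX l)) := by
  rw [subForm_apply, vol_apply]
  have h : ((Matrix.of fun i => T (update w k v i)).updateCol l fun i => θ (update w k v i))
      = ((Matrix.of fun i => T (w i)).updateCol l fun i => θ (w i)).updateRow k
        (θ v • dX l) := by
    ext i j
    by_cases hi : i = k
    · subst hi
      by_cases hj : j = l
      · subst hj; simp
      · simp [hj, hv]
    · by_cases hj : j = l
      · subst hj; simp [hi]
      · simp [hi, hj]
  rw [h, Matrix.det_updateRow_smul]
  congr 1
  -- the two matrices differ by multiples of the row `k`, which is the unit vector `∂_l`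
  refine Matrix.det_eq_of_forall_row_eq_smul_add_const
    (fun i => if i = k then 0 else θ (w i) - T (w i) l) k (by simp) fun i j => ?_
  by_cases hi : i = k
  · subst hi; simp
  · by_cases hj : j = l
    · subst hj; simp [hi]
    · simp [hi, hj]

/-- An `n`-form which vanishes as soon as one argument is in the kernel of a linear map `T` split
by `S` is determined by its values on the range of `S`. -/
theorem alternating_eq_of_vertical (T : F →L[ℝ] EX n) (S : EX n →L[ℝ] F)
    (hTS : ∀ v, T (S v) = v) {α β : F [⋀^Fin n]→L[ℝ] ℝ}
    (hv : ∀ (v : F), T v = 0 → ∀ w k, α (update w k v) = β (update w k v))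
    (hS : α (fun k => S (dX k)) = β fun k => S (dX k)) : α = β := by
  rw [← sub_eq_zero]
  set γ := α - β with hγ
  have h0 : ∀ (v : F), T v = 0 → ∀ w k, γ (update w k v) = 0 := fun v hTv w k => by
    simp [hγ, hv v hTv w k]
  have h1 : γ.compContinuousLinearMap S = 0 := by
    rw [eq_smul_vol (γ.compContinuousLinearMap S)]
    have : γ (fun k => S (dX k)) = 0 := by simp [hγ, hS]
    simp [Function.comp_def, this]
  ext w
  have key : ∀ s : Finset (Fin n), γ (s.piecewise (fun i => S (T (w i))) w) = γ w := by
    intro s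
    induction s using Finset.induction_on with
    | empty => simp
    | insert i s hi ih =>
      rw [Finset.piecewise_insert, ← ih]
      have e : S (T (w i)) = s.piecewise (fun i => S (T (w i))) w i - (w i - S (T (w i))) := by
        rw [Finset.piecewise_eq_of_notMem _ _ _ hi]; abel
      rw [e, γ.map_update_sub, h0 (w i - S (T (w i))) (by rw [map_sub, hTS, sub_self]), sub_zero,
        update_eq_self]
  rw [← key Finset.univ, Finset.piecewise_univ]
  exact congrArg (fun f => f fun i => T (w i)) h1

/-- In the expansion of `extDeriv` at `(v, a₁, …, aₙ)`, the tuple without `aᵢ` is, up to the sign of a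
cyclic permutation, the tuple `a` with `aᵢ` replaced by `v`. -/
theorem alternating_removeNth_succ_cons (γ : F [⋀^Fin n]→L[ℝ] ℝ) (v : F) (a : Fin n → F)
    (i : Fin n) :
    (-1) ^ (i : ℕ) * γ (i.succ.removeNth (Fin.cons v a : Fin (n + 1) → F)) = γ (update a i v) := by
  obtain _ | n := n
  · exact i.elim0
  · have h1 : (i.succ.removeNth (Fin.cons v a : Fin (n + 2) → F))
        = Matrix.vecCons v (i.removeNth a) := by
      funext j
      refine Fin.cases ?_ (fun j => ?_) j
      · simp [Fin.removeNth]
      · simp [Fin.removeNth]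
    have h2 : update a i v = i.insertNth v (i.removeNth a) := by
      rw [Fin.insertNth_removeNth]
    rw [h1, h2, γ.map_insertNth]
    simp

end SubForm

/-! ### Hamiltonian forms in coordinates -/

section Coordinates
variable {n m : ℕ}

/-- The `n`-form `p^λ_i dy^i ∧ ω_λ - h ω` on the model space of `Y`, for fixed momenta `p` and a
constant `h`: the value of a Hamiltonian form at a point, in coordinates. -/
def coordForm (p : Fin n → Fin m → ℝ) (h : ℝ) : EY n m [⋀^Fin n]→L[ℝ] ℝ :=
  (∑ l : Fin n, ∑ i : Fin m, p l i • subForm (ContinuousLinearMap.fst ℝ (EX n) (Fin m → ℝ)) l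
    ((ContinuousLinearMap.proj i).comp (ContinuousLinearMap.snd ℝ (EX n) (Fin m → ℝ))))
  - h • (vol n).compContinuousLinearMap (ContinuousLinearMap.fst ℝ (EX n) (Fin m → ℝ))

theorem coordForm_apply (p : Fin n → Fin m → ℝ) (h : ℝ) (w : Fin n → EY n m) :
    coordForm p h w = (∑ l : Fin n, ∑ i : Fin m,
      p l i * subForm (ContinuousLinearMap.fst ℝ (EX n) (Fin m → ℝ)) l
        ((ContinuousLinearMap.proj i).comp (ContinuousLinearMap.snd ℝ (EX n) (Fin m → ℝ))) w)
      - h * vol n fun k => (w k).1 := by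
  simp [coordForm, Function.comp_def]

theorem coordForm_apply_of_eq (p : Fin n → Fin m → ℝ) (h : ℝ) {w : Fin n → EY n m}
    (hw : ∀ k, (w k).1 = dX k) :
    coordForm p h w = (∑ l : Fin n, ∑ i : Fin m, p l i * (w l).2 i) - h := by
  rw [coordForm_apply]
  simp only [hw, vol_dX, mul_one]
  congr 1
  refine Finset.sum_congr rfl fun l _ => Finset.sum_congr rfl fun i _ => ?_
  rw [subForm_apply_of_eq _ _ _ (by simpa using hw)]
  rfl

theorem coordForm_update (p : Fin n → Fin m → ℝ) (h : ℝ) (w : Fin n → EY n m) (k : Fin n)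
    {v : EY n m} (hv : v.1 = 0) :
    coordForm p h (update w k v) = ∑ l : Fin n, ∑ i : Fin m,
      p l i * (v.2 i * vol n (update (fun j => (w j).1) k (dX l))) := by
  rw [coordForm_apply]
  have h0 : vol n (fun j => (update w k v j).1) = 0 :=
    (vol n).map_coord_zero k (by simp [hv])
  rw [h0, mul_zero, sub_zero]
  refine Finset.sum_congr rfl fun l _ => Finset.sum_congr rfl fun i _ => ?_
  rw [subForm_update _ _ _ _ _ (by simpa using hv)]
  rfl

theorem coordForm_update_of_eq (p : Fin n → Fin m → ℝ) (h : ℝ) {w : Fin n → EY n m}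
    (hw : ∀ k, (w k).1 = dX k) (k : Fin n) {v : EY n m} (hv : v.1 = 0) :
    coordForm p h (update w k v) = ∑ i : Fin m, p k i * v.2 i := by
  rw [coordForm_update p h w k hv]
  rw [Finset.sum_eq_single k]
  · simp [hw, update_eq_self, vol_dX]
  · intro l _ hl
    refine Finset.sum_eq_zero fun i _ => ?_
    rw [(vol n).map_eq_zero_of_eq _ (i := k) (j := l), mul_zero, mul_zero]
    · simp [hl, hw]
    · exact hl.symm
  · simp

/-- The Hamiltonian form `p^λ_i dy^i ∧ ω_λ - h ω` with Hamiltonian `h`, as a differential form on the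
model space of the Legendre bundle. -/
def coordDForm (h : EP n m → ℝ) (z : EP n m) : EP n m [⋀^Fin n]→L[ℝ] ℝ :=
  (coordForm z.2 (h z)).compContinuousLinearMap
    (ContinuousLinearMap.fst ℝ (EY n m) (Fin n → Fin m → ℝ))

theorem differentiableAt_coordForm {h : EP n m → ℝ} {z : EP n m} (hh : DifferentiableAt ℝ h z) :
    DifferentiableAt ℝ (fun z : EP n m => coordForm z.2 (h z)) z := by
  unfold coordForm
  fun_prop

theorem differentiableAt_coordDForm {h : EP n m → ℝ} {z : EP n m} (hh : DifferentiableAt ℝ h z) :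
    DifferentiableAt ℝ (coordDForm h) z := by
  have h1 : DifferentiableAt ℝ (ContinuousAlternatingMap.compContinuousLinearMapCLM (ι := Fin n)
      (F := ℝ) (ContinuousLinearMap.fst ℝ (EY n m) (Fin n → Fin m → ℝ)))
      (coordForm z.2 (h z)) := ContinuousLinearMap.differentiableAt _
  exact h1.comp z (differentiableAt_coordForm hh)

/-- The derivative of `p^λ_i dy^i ∧ ω_λ - h ω` along `u` is a form of the same shape, with the momentum
components of `u` for `p` and `dh(u)` for `h`. -/
theorem fderiv_coordDForm_apply {h : EP n m → ℝ} {z : EP n m} (hh : DifferentiableAt ℝ h z)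
    (w : Fin n → EP n m) (u : EP n m) :
    fderiv ℝ (fun z => coordDForm h z w) z u
      = coordForm u.2 (fderiv ℝ h z u) fun k => (w k).1 := by
  have h1 : ∀ l i, HasFDerivAt (fun z : EP n m => z.2 l i)
      ((ContinuousLinearMap.proj i).comp ((ContinuousLinearMap.proj (R := ℝ) l).comp
        (ContinuousLinearMap.snd ℝ (EY n m) (Fin n → Fin m → ℝ)))) z := fun l i =>
    ((ContinuousLinearMap.proj (R := ℝ) (φ := fun _ : Fin m => ℝ) i).comp
      ((ContinuousLinearMap.proj (R := ℝ) (φ := fun _ : Fin n => Fin m → ℝ) l).comp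
        (ContinuousLinearMap.snd ℝ (EY n m) (Fin n → Fin m → ℝ)))).hasFDerivAt
  have h2 := (HasFDerivAt.fun_sum (u := Finset.univ) fun l _ =>
      HasFDerivAt.fun_sum (u := Finset.univ) fun i _ => (h1 l i).mul_const
        (subForm (ContinuousLinearMap.fst ℝ (EX n) (Fin m → ℝ)) l ((ContinuousLinearMap.proj i).comp
          (ContinuousLinearMap.snd ℝ (EX n) (Fin m → ℝ))) fun k => (w k).1)).fun_sub
    (hh.hasFDerivAt.mul_const (vol n fun k => (w k).1.1))
  have h3 : (fun z => coordDForm h z w) = _ := funext fun z : EP n m =>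
    coordForm_apply z.2 (h z) fun k => (w k).1
  rw [h3, h2.fderiv, coordForm_apply]
  simp [mul_comm]

/-- The covariant Hamilton equations in coordinates: if the tangent map `A` of a section satisfies
them at `z`, then `dH` vanishes on a vertical vector followed by tangent vectors of the section. -/
theorem extDeriv_coordDForm_eq_zero {h : EP n m → ℝ} {z : EP n m} (hh : DifferentiableAt ℝ h z)
    (A : EX n →L[ℝ] EP n m) (hA : ∀ w, (A w).1.1 = w)
    (hy : ∀ l i, (A (dX l)).1.2 i = fderiv ℝ h z (0, Pi.single l (Pi.single i 1)))
    (hp : ∀ i, ∑ l, (A (dX l)).2 l i = - fderiv ℝ h z ((0, Pi.single i 1), 0))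
    {v : EP n m} (hv : v.1.1 = 0) (w : Fin n → EX n) :
    extDeriv (coordDForm h) z (Fin.cons v fun i => A (w i)) = 0 := by
  have key : extDeriv (coordDForm h) z (Fin.cons v fun i => A (dX i)) = 0 := by
    -- the term differentiated along `v`, and those differentiated along the section
    rw [extDeriv_apply (differentiableAt_coordDForm hh), Fin.sum_univ_succ]
    simp only [fderiv_coordDForm_apply hh, Fin.cons_zero, Fin.cons_succ, Fin.val_zero, pow_zero,
      one_smul, Fin.val_succ, zsmul_eq_mul, Int.cast_pow, Int.cast_neg, Int.cast_one]
    have e0 : coordForm v.2 (fderiv ℝ h z v) (fun k =>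
        ((0 : Fin (n + 1)).removeNth (Fin.cons v (fun i => A (dX i)) : Fin (n + 1) → EP n m) k).1)
        = (∑ l : Fin n, ∑ i : Fin m, v.2 l i * (A (dX l)).1.2 i) - fderiv ℝ h z v := by
      rw [coordForm_apply_of_eq]
      · simp [Fin.removeNth]
      · intro k; simp [Fin.removeNth, hA]
    have e1 : ∀ j : Fin n, (-1) ^ ((j : ℕ) + 1) * coordForm (A (dX j)).2 (fderiv ℝ h z (A (dX j)))
        (fun k => (j.succ.removeNth
          (Fin.cons v (fun i => A (dX i)) : Fin (n + 1) → EP n m) k).1)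
        = - ∑ i : Fin m, (A (dX j)).2 j i * v.1.2 i := by
      intro j
      have := alternating_removeNth_succ_cons
        ((coordForm (A (dX j)).2 (fderiv ℝ h z (A (dX j)))).compContinuousLinearMap
          (ContinuousLinearMap.fst ℝ (EY n m) (Fin n → Fin m → ℝ))) v (fun i => A (dX i)) j
      rw [pow_succ, mul_neg_one, neg_mul]
      congr 1
      refine this.trans ?_
      have e : (⇑(ContinuousLinearMap.fst ℝ (EY n m) (Fin n → Fin m → ℝ)) ∘
          update (fun i => A (dX i)) j v) = update (fun i => (A (dX i)).1) j v.1 := by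
        rw [comp_update]; rfl
      change coordForm _ _ (_ ∘ _) = _
      refine (congrArg _ e).trans ?_
      rw [coordForm_update_of_eq _ _ (fun k => hA _) j hv]
    rw [e0, Finset.sum_congr rfl fun j _ => e1 j]
    have hexp : v = ∑ i : Fin m, v.1.2 i • (((0, Pi.single i 1), 0) : EP n m)
        + ∑ l : Fin n, ∑ i : Fin m, v.2 l i • ((0, Pi.single l (Pi.single i 1)) : EP n m) := by
      refine Prod.ext (Prod.ext ?_ ?_) ?_
      · simp [Prod.fst_sum, hv]
      · funext i
        simp [Prod.fst_sum, Prod.snd_sum, Finset.sum_apply, Pi.single_apply]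
      · funext l i
        simp only [Prod.snd_add, Prod.snd_sum, Prod.smul_snd, smul_zero, Finset.sum_const_zero,
          zero_add, Finset.sum_apply, Pi.smul_apply]
        rw [Finset.sum_eq_single l, Finset.sum_eq_single i]
        · simp
        · intro j _ hj; simp [Ne.symm hj]
        · simp
        · intro j _ hj; simp [Ne.symm hj]
        · simp
    have hdh : fderiv ℝ h z v = ∑ i : Fin m, v.1.2 i * (- ∑ l, (A (dX l)).2 l i)
        + ∑ l : Fin n, ∑ i : Fin m, v.2 l i * (A (dX l)).1.2 i := by
      conv_lhs => rw [hexp]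
      simp only [map_add, map_sum, map_smul, smul_eq_mul, hy, hp, neg_neg]
    rw [hdh, Finset.sum_neg_distrib, Finset.sum_comm (s := Finset.univ (α := Fin n))
      (f := fun l i => (A (dX l)).2 l i * v.1.2 i)]
    simp only [mul_neg, Finset.mul_sum, Finset.sum_neg_distrib]
    simp only [mul_comm (v.1.2 _)]
    ring
  -- the left-hand side is an `n`-form in `w`, hence determined by its value on the `∂_λ`
  have h1 := eq_smul_vol (((extDeriv (coordDForm h) z).curryLeft v).compContinuousLinearMap A)
  have h2 := congrArg (fun f => f w) h1
  refine h2.trans ?_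
  rw [ContinuousAlternatingMap.smul_apply]
  exact mul_eq_zero_of_left key _

end Coordinates

/-! ### Charts of the jet manifold and of the Legendre bundle -/

section Charts
variable {n m : ℕ} {X : Type v} [TopologicalSpace X] [ChartedSpace (EX n) X]
  {Y : Type u} [TopologicalSpace Y] [ChartedSpace (EY n m) Y] {π : FieldBundle n m X Y}
  [IsManifold 𝓘(ℝ, EX n) ∞ X]

namespace FibredChart
variable (c : FibredChart π)

/-- The holonomic coordinates of `Π` as an element of its atlas. -/
def legHomeo : OpenPartialHomeomorph (Legendre π) (EP n m) :=
  (legCore π).openPartialHomeomorph c.legChart (mem_range_self c)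

theorem legHomeo_mem_maximalAtlas :
    c.legHomeo ∈ IsManifold.maximalAtlas 𝓘(ℝ, EP n m) ∞ (Legendre π) := by
  refine IsManifold.subset_maximalAtlas ?_
  change _ ∈ ⋃ (e : PartialEquiv (Legendre π) (EP n m)) (he : e ∈ (legCore π).atlas),
    {(legCore π).openPartialHomeomorph e he}
  simp only [mem_iUnion, mem_singleton_iff]
  exact ⟨c.legChart, mem_range_self c, rfl⟩

theorem isOpen_legSource : IsOpen {q : Legendre π | q.base ∈ c.toTotal.source} :=
  c.legHomeo.open_source

theorem isOpen_legTarget : IsOpen (c.toTotal.target ×ˢ (univ : Set (Fin n → Fin m → ℝ))) :=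
  c.legHomeo.open_target

theorem contMDiffOn_legChart : ContMDiffOn 𝓘(ℝ, EP n m) 𝓘(ℝ, EP n m) ∞ c.legChart
    {q | q.base ∈ c.toTotal.source} :=
  contMDiffOn_of_mem_maximalAtlas c.legHomeo_mem_maximalAtlas

theorem contMDiffOn_legChart_symm : ContMDiffOn 𝓘(ℝ, EP n m) 𝓘(ℝ, EP n m) ∞ c.legChart.symm
    (c.toTotal.target ×ˢ univ) :=
  contMDiffOn_symm_of_mem_maximalAtlas c.legHomeo_mem_maximalAtlas

variable [Nonempty Y]

/-- The adapted coordinates of `J¹Y` as an element of its atlas. -/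
def jetHomeo : OpenPartialHomeomorph (Jet π) (EJ n m) :=
  (jetCore π).openPartialHomeomorph (c.jetChart (Classical.arbitrary _)) (mem_range_self c)

theorem jetHomeo_mem_maximalAtlas :
    c.jetHomeo ∈ IsManifold.maximalAtlas 𝓘(ℝ, EJ n m) ∞ (Jet π) := by
  refine IsManifold.subset_maximalAtlas ?_
  change _ ∈ ⋃ (e : PartialEquiv (Jet π) (EJ n m)) (he : e ∈ (jetCore π).atlas),
    {(jetCore π).openPartialHomeomorph e he}
  simp only [mem_iUnion, mem_singleton_iff]
  exact ⟨c.jetChart (Classical.arbitrary _), mem_range_self c, rfl⟩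

theorem isOpen_jetSource : IsOpen {j : Jet π | j.base ∈ c.toTotal.source} :=
  c.jetHomeo.open_source

theorem contMDiffOn_jetChart : ContMDiffOn 𝓘(ℝ, EJ n m) 𝓘(ℝ, EJ n m) ∞
    (fun j : Jet π => ((c.toTotal j.base, c.jetCoord j.fib) : EJ n m))
    {j | j.base ∈ c.toTotal.source} :=
  contMDiffOn_of_mem_maximalAtlas c.jetHomeo_mem_maximalAtlas

theorem contMDiffOn_jetChart_symm : ContMDiffOn 𝓘(ℝ, EJ n m) 𝓘(ℝ, EJ n m) ∞
    (c.jetChart (Classical.arbitrary (Jet π))).symm (c.toTotal.target ×ˢ univ) :=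
  contMDiffOn_symm_of_mem_maximalAtlas c.jetHomeo_mem_maximalAtlas

end FibredChart

open FibredChart

theorem contMDiff_legBase :
    ContMDiff 𝓘(ℝ, EP n m) 𝓘(ℝ, EY n m) ∞ (Legendre.base : Legendre π → Y) := by
  intro q
  let c := fibredChartAt π q.base
  have hq : q.base ∈ c.toTotal.source := mem_fibredChartAt π q.base
  have h : ContMDiffOn 𝓘(ℝ, EP n m) 𝓘(ℝ, EY n m) ∞
      (fun q : Legendre π => c.toTotal.symm (c.legChart q).1) {q | q.base ∈ c.toTotal.source} :=
    c.total_smooth.smooth_symm.comp (contDiff_fst.contMDiff.comp_contMDiffOn c.contMDiffOn_legChart)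
      fun q hq => c.toTotal.map_source hq
  exact (h.congr fun q hq => (c.toTotal.left_inv hq).symm).contMDiffAt
    (c.isOpen_legSource.mem_nhds hq)

namespace HamiltonianForm
variable (H : HamiltonianForm π) (c : FibredChart π)

theorem ham_legChart {q : Legendre π} (hq : q.base ∈ c.toTotal.source) :
    H.ham c (c.legChart q) = - H.toFun q fun k => c.dTotSymm q.base (dX k, 0) := by
  have h : c.legChart.symm (c.legChart q) = q := c.legChart.left_inv hq
  rw [ham, h]

theorem contDiffOn_ham : ContDiffOn ℝ ∞ (H.ham c) (c.toTotal.target ×ˢ univ) := by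
  rw [← contMDiffOn_iff_contDiffOn]
  exact (H.smooth c).comp c.contMDiffOn_legChart_symm fun z hz => c.legChart.map_target hz

theorem differentiableAt_ham {q : Legendre π} (hq : q.base ∈ c.toTotal.source) :
    DifferentiableAt ℝ (H.ham c) (c.legChart q) :=
  ((H.contDiffOn_ham c).contDiffAt
    (c.isOpen_legTarget.mem_nhds (c.legChart.map_source hq))).differentiableAt (by simp)

/-- In fibred coordinates `H = p^λ_i dy^i ∧ ω_λ - 𝓗 ω`. -/
theorem toFun_eq_coordForm {q : Legendre π} (hq : q.base ∈ c.toTotal.source) :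
    H.toFun q = (coordForm (c.legChart q).2 (H.ham c (c.legChart q))).compContinuousLinearMap
      (c.dTot q.base) := by
  have key : (H.toFun q).compContinuousLinearMap (c.dTotSymm q.base)
      = coordForm (c.legChart q).2 (H.ham c (c.legChart q)) := by
    refine alternating_eq_of_vertical (ContinuousLinearMap.fst ℝ (EX n) (Fin m → ℝ))
      (ContinuousLinearMap.inl ℝ (EX n) (Fin m → ℝ)) (fun v => rfl) (fun v hv w k => ?_) ?_
    · rw [coordForm_update _ _ _ _ (show v.1 = 0 from hv)]
      obtain ⟨v1, a⟩ := v
      obtain rfl : v1 = 0 := hv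
      have hval : (H.toFun q).compContinuousLinearMap (c.dTotSymm q.base) (update w k (0, a))
          = H.toFun q (update (fun j => c.dTotSymm q.base (w j)) k
            ((⟨_, dTotSymm_mem_vert hq a⟩ : Vert π q.base) : EY n m)) := by
        change H.toFun q (_ ∘ _) = _
        refine congrArg _ ?_
        exact comp_update _ _ _ _
      rw [hval, H.isSection]
      have hfib : q.fib = c.legFib q.base (c.legCoord q.fib) := (c.legFib_legCoord hq _).symm
      simp only [tproj_dTotSymm hq]
      rw [hfib]
      simp only [legFib_apply, dTot_dTotSymm hq]
      change _ = ∑ l, ∑ i, c.legCoord q.fib l i * (a i * _)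
      have hb : ∀ l, (fun j => c.dBase q.base
          (update (fun i => c.dBaseSymm q.base (w i).1) k (dX l) j))
          = update (fun i => (w i).1) k (c.dBase q.base (dX l)) := by
        intro l
        refine (comp_update (c.dBase q.base) _ _ _).trans ?_
        simp [Function.comp_def, dBase_dBaseSymm hq]
      simp only [hb, Finset.sum_mul]
      rw [Finset.sum_comm]
      refine Finset.sum_congr rfl fun l' _ => ?_
      rw [Finset.sum_comm]
      refine Finset.sum_congr rfl fun i _ => ?_
      -- expand `∂_{l'}` in the basis of the tangent space in which `H.isSection` is written
      have hd : (dX l' : EX n) = ∑ l, (c.dBaseSymm q.base (dX l') l) • c.dBase q.base (dX l) := by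
        conv_lhs => rw [← dBase_dBaseSymm hq (dX l'),
          ← Finset.univ_sum_single (c.dBaseSymm q.base (dX l'))]
        rw [map_sum]
        refine Finset.sum_congr rfl fun l _ => ?_
        rw [← map_smul]
        congr 1
        simp [dX, ← Pi.single_smul]
      have hvol : vol n (update (fun j => (w j).1) k (dX l')) = ∑ l,
          (c.dBaseSymm q.base (dX l') l) *
            vol n (update (fun j => (w j).1) k (c.dBase q.base (dX l))) := by
        conv_lhs => rw [hd]
        refine ((vol n).toAlternatingMap.map_update_sum Finset.univ k _ _).trans ?_
        exact Finset.sum_congr rfl fun l _ => (vol n).map_update_smul _ _ _ _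
      rw [hvol, Finset.mul_sum, Finset.mul_sum]
      refine Finset.sum_congr rfl fun l _ => ?_
      change _ * (_ * c.dBaseSymm q.base (dX l') l) * _ = _
      ring
    · rw [coordForm_apply_of_eq _ _ (fun k => rfl), H.ham_legChart c hq]
      simp [Function.comp_def]
  rw [← key]
  ext w
  simp [Function.comp_def, dTotSymm_dTot hq]

end HamiltonianForm

variable [Nonempty Y]

theorem contMDiff_jetBase :
    ContMDiff 𝓘(ℝ, EJ n m) 𝓘(ℝ, EY n m) ∞ (Jet.base : Jet π → Y) := by
  intro j
  let c := fibredChartAt π j.base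
  have hj : j.base ∈ c.toTotal.source := mem_fibredChartAt π j.base
  have h : ContMDiffOn 𝓘(ℝ, EJ n m) 𝓘(ℝ, EY n m) ∞
      (fun j : Jet π => c.toTotal.symm (c.toTotal j.base)) {j | j.base ∈ c.toTotal.source} :=
    c.total_smooth.smooth_symm.comp (contDiff_fst.contMDiff.comp_contMDiffOn c.contMDiffOn_jetChart)
      fun q hq => c.toTotal.map_source hq
  exact (h.congr fun q hq => (c.toTotal.left_inv hq).symm).contMDiffAt
    (c.isOpen_jetSource.mem_nhds hj)

end Charts

/-! ### The Poincaré–Cartan form on the fibres of the Legendre map -/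

section Fibre
variable {n m : ℕ} {X : Type v} [TopologicalSpace X] [ChartedSpace (EX n) X]
  {Y : Type u} [TopologicalSpace Y] [ChartedSpace (EY n m) Y] {π : FieldBundle n m X Y}

open FibredChart

/-- The contraction `b ↦ p^λ_i b^i_λ ω` of a momentum `q` with a linear map `b : T_x X → V_y Y`. -/
def momentumPairing {y : Y} (q : LegFib π y) :
    (EX n →L[ℝ] Vert π y) →L[ℝ] (EX n [⋀^Fin n]→L[ℝ] ℝ) :=
  LinearMap.toContinuousLinearMap
    { toFun := fun b : EX n →L[ℝ] Vert π y => ∑ l : Fin n, q (b (dX l)) (coX l)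
      map_add' := fun b b' => by simp [Finset.sum_add_distrib]
      map_smul' := fun t b => by simp [Finset.smul_sum] }

theorem momentumPairing_apply {y : Y} (q : LegFib π y) (b : EX n →L[ℝ] Vert π y) :
    momentumPairing q b = ∑ l : Fin n, q (b (dX l)) (coX l) := rfl

theorem JetFib.add_add {y : Y} (j : JetFib π y) (b b' : EX n →L[ℝ] Vert π y) :
    j.add (b + b') = (j.add b).add b' := by
  ext1
  simp [JetFib.add, ContinuousLinearMap.comp_add, add_assoc]

theorem momentumForm_eq_sum {y : Y} (q : LegFib π y) (j : JetFib π y) :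
    momentumForm q j = ∑ l : Fin n, subForm (tproj π y) l (momentumCovector q j l) := rfl

/-- The form `p^λ_i (dy^i - y^i_μ dx^μ) ∧ ω_λ` is affine in the velocities `y^i_μ`. -/
theorem momentumForm_add {y : Y} (q : LegFib π y) (j : JetFib π y) (b : EX n →L[ℝ] Vert π y) :
    momentumForm q (j.add b)
      = momentumForm q j - (momentumPairing q b).compContinuousLinearMap (tproj π y) := by
  have h1 : (momentumPairing q b).compContinuousLinearMap (tproj π y)
      = ∑ l : Fin n, (q (b (dX l)) (coX l)).compContinuousLinearMap (tproj π y) := by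
    ext w
    simp [momentumPairing_apply]
  rw [h1, momentumForm_eq_sum, momentumForm_eq_sum, ← Finset.sum_sub_distrib]
  refine Finset.sum_congr rfl fun l _ => ?_
  let μ : EX n →L[ℝ] ℝ := LinearMap.toContinuousLinearMap
    { toFun := fun v => q (b v) (coX l) fun k => dX k
      map_add' := fun v v' => by simp
      map_smul' := fun t v => by simp }
  have h2 : momentumCovector q (j.add b) l
      = momentumCovector q j l - μ.comp (tproj π y) := by
    refine ContinuousLinearMap.ext fun w => ?_
    have h3 : (j.add b).vertPart w = j.vertPart w - b (tproj π y w) := by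
      ext1
      change w - (j.lin (tproj π y w) + b (tproj π y w)) = w - j.lin (tproj π y w) - _
      abel
    change q ((j.add b).vertPart w) (coX l) _ =
      q (j.vertPart w) (coX l) _ - q (b (tproj π y w)) (coX l) _
    rw [h3, map_sub]
    rfl
  have h4 : subForm (tproj π y) l (μ.comp (tproj π y))
      = (q (b (dX l)) (coX l)).compContinuousLinearMap (tproj π y) := by
    have := subForm_comp (ContinuousLinearMap.id ℝ (EX n)) l μ (tproj π y)
    rw [ContinuousLinearMap.id_comp] at this
    rw [this, subForm_id, eq_smul_vol (q (b (dX l)) (coX l))]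
    rfl
  rw [h2, subForm_sub, h4]

variable [IsManifold 𝓘(ℝ, EX n) ∞ X] [Nonempty Y]

/-- The Legendre map on the fibre of `J¹Y` over `y`. -/
def legendreFib (L : Lagrangian π) {y : Y} (j : JetFib π y) : LegFib π y :=
  (legendreMap L ⟨y, j⟩).fib

/-- `dL` along the fibre is the pairing with the Legendre momentum, at every jet of the fibre: in the
definition of the Legendre map the jet is the origin of the affine fibre. -/
theorem fderiv_lagrangian_add (L : Lagrangian π) {y : Y} (j : JetFib π y)
    (b h : EX n →L[ℝ] Vert π y) :
    fderiv ℝ (fun b => L.toFun ⟨y, j.add b⟩) b h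
      = momentumPairing (legendreFib L (j.add b)) h := by
  have h1 : fderiv ℝ (fun b => L.toFun ⟨y, j.add b⟩) b
      = fderiv ℝ (fun b' => L.toFun ⟨y, (j.add b).add b'⟩) 0 := by
    simp only [← JetFib.add_add]
    have := fderiv_comp_add_left (𝕜 := ℝ) (f := fun b => L.toFun ⟨y, j.add b⟩) (x := 0) b
    exact (congrArg (fderiv ℝ _) (add_zero b).symm).trans this.symm
  have h2 : h = ∑ l : Fin n, (coX l).smulRight (h (dX l)) := by
    ext1 v
    conv_lhs => rw [← Finset.univ_sum_single v]
    rw [map_sum, sum_apply]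
    refine Finset.sum_congr rfl fun l _ => ?_
    have : (Pi.single l (v l) : EX n) = v l • dX l := by simp [dX, ← Pi.single_smul]
    rw [this, map_smul]
    rfl
  rw [h1, momentumPairing_apply]
  conv_lhs => rw [h2]
  rw [map_sum]
  rfl

namespace FibredChart
variable (c : FibredChart π)

omit [IsManifold 𝓘(ℝ, EX n) ∞ X] [Nonempty Y] in
theorem jetCoord_add {y : Y} (j : JetFib π y) (b : EX n →L[ℝ] Vert π y) :
    c.jetCoord (j.add b) = c.jetCoord j + (ContinuousLinearMap.snd ℝ (EX n) (Fin m → ℝ)).comp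
      ((c.dTot y).comp ((Vert π y).subtypeL.comp (b.comp (c.dBaseSymm y)))) := by
  ext1 v
  simp [jetCoord, JetFib.add]

end FibredChart

theorem differentiable_lagrangian_add (L : Lagrangian π) {y : Y} (j : JetFib π y) :
    Differentiable ℝ (fun b : EX n →L[ℝ] Vert π y => L.toFun ⟨y, j.add b⟩) := by
  let c := fibredChartAt π y
  have hy : y ∈ c.toTotal.source := mem_fibredChartAt π y
  have h1 : ContDiff ℝ ∞ (fun b : EX n →L[ℝ] Vert π y =>
      ((c.toTotal y, c.jetCoord (j.add b)) : EJ n m)) := by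
    simp only [c.jetCoord_add]
    fun_prop
  have h2 : ContMDiff 𝓘(ℝ, EX n →L[ℝ] Vert π y) 𝓘(ℝ, EJ n m) ∞
      (fun b : EX n →L[ℝ] Vert π y => (⟨y, j.add b⟩ : Jet π)) := by
    have := c.contMDiffOn_jetChart_symm.comp h1.contMDiff.contMDiffOn (s := univ)
      fun b _ => ⟨c.toTotal.map_source hy, mem_univ _⟩
    rw [← contMDiffOn_univ]
    refine this.congr fun b _ => ?_
    exact ((c.jetChart (Classical.arbitrary (Jet π))).left_inv
      (show (⟨y, j.add b⟩ : Jet π) ∈ (c.jetChart (Classical.arbitrary (Jet π))).source from hy)).symm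
  have h3 : ContMDiff 𝓘(ℝ, EX n →L[ℝ] Vert π y) 𝓘(ℝ, ℝ) ∞
      (fun b : EX n →L[ℝ] Vert π y => L.toFun ⟨y, j.add b⟩ fun k => c.dBaseSymm y (dX k)) := by
    rw [← contMDiffOn_univ]
    exact (L.smooth c).comp h2.contMDiffOn fun b _ => hy
  have h4 : (fun b : EX n →L[ℝ] Vert π y => L.toFun ⟨y, j.add b⟩) = fun b =>
      (L.toFun ⟨y, j.add b⟩ fun k => c.dBaseSymm y (dX k)) •
        (vol n).compContinuousLinearMap (c.dBase y) :=
    funext fun b => c.form_eq_smul hy _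
  rw [h4]
  exact (h3.contDiff.differentiable (by simp)).smul_const _

/-- The coefficient form `𝓛 ω + π^λ_i (dy^i - y^i_μ dx^μ) ∧ ω_λ` on `T_y Y` at a jet over `y`; the
Poincaré–Cartan form is its pull-back to `J¹Y`. -/
def cartanForm (L : Lagrangian π) (j : Jet π) : EY n m [⋀^Fin n]→L[ℝ] ℝ :=
  (L.toFun j).compContinuousLinearMap (tproj π j.base)
    + momentumForm (legendreFib L j.fib) j.fib

/-- The linear map `T_x X → V_y Y` with coordinates `C`: the difference of two jets over `y` whose
coordinates `y^i_λ` differ by `C`. -/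
def verticalLift (c : FibredChart π) {y : Y} (hy : y ∈ c.toTotal.source)
    (C : EX n →L[ℝ] (Fin m → ℝ)) : EX n →L[ℝ] Vert π y :=
  (((c.dTotSymm y).comp (ContinuousLinearMap.inr ℝ (EX n) (Fin m → ℝ))).codRestrict (Vert π y)
    fun a => dTotSymm_mem_vert hy a).comp (C.comp (c.dBase y))

omit [IsManifold 𝓘(ℝ, EX n) ∞ X] [Nonempty Y] in
theorem verticalLift_apply (c : FibredChart π) {y : Y} (hy : y ∈ c.toTotal.source)
    (C : EX n →L[ℝ] (Fin m → ℝ)) (v : EX n) :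
    (verticalLift c hy C v : EY n m) = c.dTotSymm y (0, C (c.dBase y v)) := rfl

omit [IsManifold 𝓘(ℝ, EX n) ∞ X] [Nonempty Y] in
theorem eq_add_verticalLift (c : FibredChart π) {j j₀ : Jet π} (hj : j.base = j₀.base)
    (hy : j₀.base ∈ c.toTotal.source) :
    j = ⟨j₀.base, j₀.fib.add (verticalLift c hy (c.jetCoord j.fib - c.jetCoord j₀.fib))⟩ := by
  obtain ⟨y, f⟩ := j
  obtain ⟨y₀, f₀⟩ := j₀
  obtain rfl : y = y₀ := hj
  congr 1
  rw [← c.jetFib_jetCoord hy f, ← c.jetFib_jetCoord hy (f₀.add _)]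
  congr 1
  rw [c.jetCoord_add]
  ext1 v
  simp [verticalLift_apply, dTot_dTotSymm hy, dBase_dBaseSymm hy, -map_sub]
  exact congrArg (fun g => g v) (c.jetCoord_jetFib hy _).symm

/-- The Lagrangian minus the pairing with a fixed momentum `q` is stationary, along the
fibre of `J¹Y`, at the jets with Legendre momentum `q`. Hence the coefficient form of the
Poincaré–Cartan form is constant on the connected preimages of the Legendre map. -/
theorem cartanForm_eq_of_legendreMap_eq (L : Lagrangian π) (hL : IsSemiregular L) {j j' : Jet π}
    (h : legendreMap L j = legendreMap L j') : cartanForm L j = cartanForm L j' := by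
  obtain ⟨hconn, hsub⟩ := hL (legendreMap L j') (mem_range_self j')
  set S : Set (Jet π) := legendreMap L ⁻¹' {legendreMap L j'}
  obtain ⟨d, _, _, hemb⟩ := hsub
  have hloc : IsLocallyConstant (fun s : S => cartanForm L s.1) := by
    rw [IsLocallyConstant.iff_eventually_eq]
    intro s₀
    let j₀ : Jet π := s₀.1
    let c := fibredChartAt π j₀.base
    have hy : j₀.base ∈ c.toTotal.source := mem_fibredChartAt π j₀.base
    have hleg : ∀ s : S, legendreMap L s.1 = legendreMap L j₀ := fun s =>
      (show legendreMap L s.1 = _ from s.2).trans (show legendreMap L s₀.1 = _ from s₀.2).symm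
    have hbase : ∀ s : S, s.1.base = j₀.base := fun s => congrArg Legendre.base (hleg s)
    let b : S → (EX n →L[ℝ] Vert π j₀.base) := fun s =>
      verticalLift c hy (c.jetCoord s.1.fib - c.jetCoord j₀.fib)
    have hb : ∀ s : S, s.1 = ⟨j₀.base, j₀.fib.add (b s)⟩ := fun s =>
      eq_add_verticalLift c (hbase s) hy
    have hfib : ∀ s : S, legendreFib L (j₀.fib.add (b s)) = legendreFib L j₀.fib := by
      intro s
      have h1 := hleg s
      rw [hb s] at h1
      have h2 : (⟨j₀.base, legendreFib L (j₀.fib.add (b s))⟩ : Legendre π)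
        = ⟨j₀.base, legendreFib L j₀.fib⟩ := h1
      rw [Legendre.mk.injEq] at h2
      exact eq_of_heq h2.2
    let K : (EX n →L[ℝ] Vert π j₀.base) → (EX n [⋀^Fin n]→L[ℝ] ℝ) := fun β =>
      L.toFun ⟨j₀.base, j₀.fib.add β⟩ - momentumPairing (legendreFib L j₀.fib) β
    have hcart : ∀ s : S, cartanForm L s.1
        = (K (b s)).compContinuousLinearMap (tproj π j₀.base)
          + momentumForm (legendreFib L j₀.fib) j₀.fib := by
      intro s
      have h1 : cartanForm L s.1 = cartanForm L ⟨j₀.base, j₀.fib.add (b s)⟩ :=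
        congrArg _ (hb s)
      rw [h1]
      change _ + momentumForm (legendreFib L (j₀.fib.add (b s))) _ = _
      rw [hfib s]
      change (L.toFun _).compContinuousLinearMap (tproj π j₀.base)
        + momentumForm (legendreFib L j₀.fib) (j₀.fib.add (b s)) = _
      rw [momentumForm_add]
      ext w
      simp only [K, ContinuousAlternatingMap.add_apply, ContinuousAlternatingMap.sub_apply,
        ContinuousAlternatingMap.compContinuousLinearMap_apply]
      ring
    have hK : ∀ s : S, HasFDerivAt (𝕜 := ℝ) K 0 (b s) := by
      intro s
      have h1 : DifferentiableAt ℝ (fun β => L.toFun ⟨j₀.base, j₀.fib.add β⟩) (b s) :=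
        differentiable_lagrangian_add L j₀.fib (b s)
      have h3 : HasFDerivAt (𝕜 := ℝ) (fun β => momentumPairing (legendreFib L j₀.fib) β)
          (momentumPairing (legendreFib L j₀.fib)) (b s) := ContinuousLinearMap.hasFDerivAt _
      have h2 := HasFDerivAt.fun_sub (𝕜 := ℝ) (E := EX n →L[ℝ] Vert π j₀.base)
        (F := EX n [⋀^Fin n]→L[ℝ] ℝ) h1.hasFDerivAt h3
      refine h2.congr_fderiv ?_
      ext1 β
      rw [sub_apply, fderiv_lagrangian_add, hfib s, sub_self]
      rfl
    -- in a chart of the preimage, `K ∘ b` has derivative zero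
    let φ := chartAt (Fin d → ℝ) s₀
    have hcoord : DifferentiableOn ℝ (fun z => b (φ.symm z)) φ.target := by
      have h1 : ContMDiffOn 𝓘(ℝ, Fin d → ℝ) 𝓘(ℝ, EJ n m) ∞
          (fun z => (Subtype.val (φ.symm z) : Jet π)) φ.target :=
        hemb.contMDiff.comp_contMDiffOn contMDiffOn_chart_symm
      have h2 := c.contMDiffOn_jetChart.comp h1
        (fun z _ => show (φ.symm z).1.base ∈ _ by rw [hbase]; exact hy)
      have h3 : DifferentiableOn ℝ (fun z => c.jetCoord (φ.symm z).1.fib) φ.target :=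
        (contDiff_snd.comp_contDiffOn h2.contDiffOn).differentiableOn (by simp)
      simp only [b, verticalLift]
      fun_prop
    have hconst : ∀ z ∈ φ.target, HasFDerivAt (𝕜 := ℝ) (fun z => K (b (φ.symm z))) 0 z := by
      intro z hz
      have h1 := ((hcoord z hz).differentiableAt (φ.open_target.mem_nhds hz)).hasFDerivAt
      have h2 := HasFDerivAt.comp (𝕜 := ℝ) (g := K) (f := fun z => b (φ.symm z)) z (hK (φ.symm z)) h1
      rwa [ContinuousLinearMap.zero_comp] at h2
    have h0 : φ s₀ ∈ φ.target := φ.map_source (mem_chart_source _ s₀)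
    obtain ⟨ε, hε, hball⟩ := Metric.isOpen_iff.1 φ.open_target _ h0
    have hev : ∀ᶠ s in nhds s₀, s ∈ φ.source ∧ φ s ∈ Metric.ball (φ s₀) ε :=
      (φ.open_source.eventually_mem (mem_chart_source _ s₀)).and
        ((φ.continuousAt (mem_chart_source _ s₀)).eventually (Metric.ball_mem_nhds _ hε))
    filter_upwards [hev] with s hs
    have := Metric.isOpen_ball.is_const_of_fderiv_eq_zero (𝕜 := ℝ)
      (convex_ball (φ s₀) ε).isPreconnected
      (fun z hz => (hconst z (hball hz)).differentiableAt.differentiableWithinAt)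
      (fun z hz => (hconst z (hball hz)).fderiv) hs.2 (Metric.mem_ball_self hε)
    rw [φ.left_inv hs.1, φ.left_inv (mem_chart_source _ s₀)] at this
    rw [hcart s, hcart s₀, this]
  have : PreconnectedSpace S := Subtype.preconnectedSpace hconn.isPreconnected
  exact hloc.apply_eq_of_preconnectedSpace ⟨j, h⟩ ⟨j', rfl⟩

end Fibre

/-! ### The constrained Hamiltonian form -/

section Constrained
variable {n m k : ℕ} {X : Type v} [TopologicalSpace X] [ChartedSpace (EX n) X]
  {Y : Type u} [TopologicalSpace Y] [ChartedSpace (EY n m) Y] {π : FieldBundle n m X Y}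
  [IsManifold 𝓘(ℝ, EX n) ∞ X] [Nonempty Y] {L : Lagrangian π}

open FibredChart

/-- Over a point `q` of the constraint space, the coefficient form of the Poincaré–Cartan form at any
jet with Legendre momentum `q` is the value at `q` of every Hamiltonian form associated with `L`:
by constancy along `L̂⁻¹(q)` it may be computed at `Ĥ q`, where it is `H_Ĥ + Ĥ^*L`. -/
theorem cartanForm_eq_hamiltonianForm (hL : IsSemiregular L) {H : HamiltonianForm π}
    (hH : H.IsAssociated L) (j : Jet π) : cartanForm L j = H.toFun (legendreMap L j) := by
  set q := legendreMap L j
  have h1 : legendreMap L (H.map q) = q := hH.legendre j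
  rw [cartanForm_eq_of_legendreMap_eq L hL (j' := H.map q) h1.symm, hH.form q]
  have h2 : legendreFib L (H.mapFib q) = q.fib := by
    have h3 : (⟨q.base, legendreFib L (H.mapFib q)⟩ : Legendre π) = ⟨q.base, q.fib⟩ := h1
    rw [Legendre.mk.injEq] at h3
    exact eq_of_heq h3.2
  change (L.toFun (H.map q)).compContinuousLinearMap (tproj π q.base)
    + momentumForm (legendreFib L (H.mapFib q)) (H.mapFib q) = _
  rw [h2, add_comm]

variable [ChartedSpace (Fin k → ℝ) (constraintSpace L)]

/-- The constrained Hamiltonian form `Ψ^*H_L` is the restriction to `N_L` of every Hamiltonian form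
associated with `L`. -/
theorem constrainedForm_eq (hL : IsSemiregular L)
    {Ψ : constraintSpace L → Jet π} (hΨ : IsLegendreSection k L Ψ)
    {H : HamiltonianForm π} (hH : H.IsAssociated L) (q : constraintSpace L) :
    constrainedForm k L Ψ q = (H.toFun q.1).compContinuousLinearMap
      (tmap (Fin k → ℝ) (EY n m) (fun q : constraintSpace L => q.1.base) q) := by
  have h1 : legendreMap L (Ψ q) = q.1 := congrArg Subtype.val (hΨ.isSection q)
  have h2 : (fun q : constraintSpace L => q.1.base) = Jet.base ∘ Ψ :=
    funext fun q => (congrArg (fun s : constraintSpace L => s.1.base) (hΨ.isSection q)).symm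
  rw [h2, tmap_comp (contMDiff_jetBase.mdifferentiable (by simp) _)
    (hΨ.smooth.mdifferentiable (by simp) _), ← h1, ← cartanForm_eq_hamiltonianForm hL hH]
  rfl

variable [IsManifold 𝓘(ℝ, Fin k → ℝ) ∞ (constraintSpace L)]

/-- In fibred coordinates the differential of the constrained Hamiltonian form is the pull-back to
`N_L` of the differential of the coordinate expression of an associated Hamiltonian form. -/
theorem d_constrainedForm (hL : IsAlmostRegular k L)
    {Ψ : constraintSpace L → Jet π} (hΨ : IsLegendreSection k L Ψ)
    {H : HamiltonianForm π} (hH : H.IsAssociated L) (c : FibredChart π) {q : constraintSpace L}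
    (hq : q.1.base ∈ c.toTotal.source) :
    (constrainedForm k L Ψ).d q
      = (extDeriv (coordDForm (H.ham c)) (c.legChart q.1)).compContinuousLinearMap
        (tmap (Fin k → ℝ) (EP n m) (fun q : constraintSpace L => c.legChart q.1) q) := by
  let φ := chartAt (Fin k → ℝ) q
  let G : (Fin k → ℝ) → EP n m := fun z => c.legChart (φ.symm z).1
  have hφ : IsSmoothChart φ := ⟨contMDiffOn_chart, contMDiffOn_chart_symm⟩
  have hqφ : q ∈ φ.source := mem_chart_source _ q
  have hval := hL.imbedded.contMDiff
  have hopen : IsOpen (φ.target ∩ φ.symm ⁻¹' {p : constraintSpace L | p.1.base ∈ c.toTotal.source}) :=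
    φ.symm.isOpen_inter_preimage (c.isOpen_legSource.preimage continuous_subtype_val)
  set W := φ.target ∩ φ.symm ⁻¹' {p : constraintSpace L | p.1.base ∈ c.toTotal.source}
  have hqW : φ q ∈ W := ⟨φ.map_source hqφ, by
    change (φ.symm (φ q)).1.base ∈ c.toTotal.source
    rw [φ.left_inv hqφ]; exact hq⟩
  have hG : ContDiffOn ℝ ∞ G W := by
    rw [← contMDiffOn_iff_contDiffOn]
    exact c.contMDiffOn_legChart.comp
      (hval.comp_contMDiffOn (hφ.smooth_symm.mono inter_subset_left)) fun z hz => hz.2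
  have hbase : ContMDiff 𝓘(ℝ, Fin k → ℝ) 𝓘(ℝ, EY n m) ∞
      (fun p : constraintSpace L => p.1.base) := contMDiff_legBase.comp hval
  have hform : DForm.pullback φ.symm (constrainedForm k L Ψ) =ᶠ[nhds (φ q)]
      fun z => (coordDForm (H.ham c) (G z)).compContinuousLinearMap (fderiv ℝ G z) := by
    filter_upwards [hopen.mem_nhds hqW] with z hz
    have hGz : DifferentiableAt ℝ G z :=
      (hG.contDiffAt (hopen.mem_nhds hz)).differentiableAt (by simp)
    have h1 : (ContinuousLinearMap.fst ℝ (EY n m) (Fin n → Fin m → ℝ)).comp (fderiv ℝ G z)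
        = (c.dTot (φ.symm z).1.base).comp ((tmap (Fin k → ℝ) (EY n m)
          (fun p : constraintSpace L => p.1.base) (φ.symm z)).comp
            (tmap (Fin k → ℝ) (Fin k → ℝ) φ.symm z)) := by
      have h2 := (hbase.mdifferentiable (by simp) (φ.symm z)).comp z (hφ.mdiff_symm hz.1)
      rw [← tmap_comp (hbase.mdifferentiable (by simp) _) (hφ.mdiff_symm hz.1)]
      refine Eq.trans ?_ (tmap_comp (g := c.toTotal)
        (f := (fun p : constraintSpace L => p.1.base) ∘ φ.symm) (c.total_smooth.mdiff hz.2) h2)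
      rw [tmap_eq_fderiv]
      exact ((ContinuousLinearMap.fst ℝ (EY n m) (Fin n → Fin m → ℝ)).hasFDerivAt.comp z
        hGz.hasFDerivAt).fderiv.symm
    change ((constrainedForm k L Ψ) (φ.symm z)).compContinuousLinearMap _ = _
    rw [constrainedForm_eq hL.semiregular hΨ hH, H.toFun_eq_coordForm c hz.2]
    ext w
    have h3 : ∀ i, (fderiv ℝ G z (w i)).1 = _ := fun i => congrArg (fun f => f (w i)) h1
    change coordForm _ _ _ = coordForm _ _ (fun i => (fderiv ℝ G z (w i)).1)
    rw [funext h3]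
    rfl
  have hGq : ContDiffAt ℝ ∞ G (φ q) := hG.contDiffAt (hopen.mem_nhds hqW)
  have hGφ : G (φ q) = c.legChart q.1 := by
    change c.legChart (φ.symm (φ q)).1 = _
    rw [φ.left_inv hqφ]
  have hham : DifferentiableAt ℝ (H.ham c) (G (φ q)) := by
    rw [hGφ]; exact H.differentiableAt_ham c hq
  have hD : tmap (Fin k → ℝ) (EP n m) (fun q : constraintSpace L => c.legChart q.1) q
      = (fderiv ℝ G (φ q)).comp (tmap (Fin k → ℝ) (Fin k → ℝ) φ q) := by
    rw [← tmap_eq_fderiv, ← tmap_comp ?_ (hφ.mdiff hqφ)]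
    · refine tmap_congr ?_
      filter_upwards [φ.open_source.mem_nhds hqφ] with p hp
      change _ = c.legChart (φ.symm (φ p)).1
      rw [φ.left_inv hp]
    · exact (hGq.differentiableAt (by simp)).mdifferentiableAt
  change (extDeriv (DForm.pullback φ.symm (constrainedForm k L Ψ)) (φ q)).compContinuousLinearMap
    (tmap (Fin k → ℝ) (Fin k → ℝ) φ q) = _
  rw [hform.extDeriv_eq, extDeriv_pullback (differentiableAt_coordDForm hham) hGq
    (by simpa using ENat.LEInfty.out), hD, hGφ]
  rfl

omit [IsManifold 𝓘(ℝ, Fin k → ℝ) ∞ (constraintSpace L)] in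
theorem contMDiffAt_legChart_val
    (hval : ContMDiff 𝓘(ℝ, Fin k → ℝ) 𝓘(ℝ, EP n m) ∞ (Subtype.val : constraintSpace L → Legendre π))
    (c : FibredChart π) {q : constraintSpace L} (hq : q.1.base ∈ c.toTotal.source) :
    ContMDiffAt 𝓘(ℝ, Fin k → ℝ) 𝓘(ℝ, EP n m) ∞ (fun p : constraintSpace L => c.legChart p.1) q :=
  ContMDiffAt.comp q (c.contMDiffOn_legChart.contMDiffAt (c.isOpen_legSource.mem_nhds hq)) (hval q)

omit [IsManifold 𝓘(ℝ, Fin k → ℝ) ∞ (constraintSpace L)] in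
/-- In holonomic coordinates, vertical vectors of `N_L → X` have vanishing components `dx^λ`. -/
theorem fst_tmap_legChart
    (hval : ContMDiff 𝓘(ℝ, Fin k → ℝ) 𝓘(ℝ, EP n m) ∞ (Subtype.val : constraintSpace L → Legendre π))
    (c : FibredChart π) {q : constraintSpace L} (hq : q.1.base ∈ c.toTotal.source)
    {u : Fin k → ℝ}
    (hu : tmap (Fin k → ℝ) (EX n) (fun p : constraintSpace L => π.proj p.1.base) q u = 0) :
    (tmap (Fin k → ℝ) (EP n m) (fun p : constraintSpace L => c.legChart p.1) q u).1.1 = 0 := by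
  have hmlv := (contMDiffAt_legChart_val hval c hq).mdifferentiableAt (by simp)
  have hnear : ∀ᶠ p : constraintSpace L in nhds q, p.1.base ∈ c.toTotal.source :=
    continuous_subtype_val.continuousAt.eventually (c.isOpen_legSource.eventually_mem hq)
  let F : EP n m →L[ℝ] EX n := (ContinuousLinearMap.fst ℝ (EX n) (Fin m → ℝ)).comp
    (ContinuousLinearMap.fst ℝ (EY n m) (Fin n → Fin m → ℝ))
  have hF : MDifferentiableAt 𝓘(ℝ, EP n m) 𝓘(ℝ, EX n) F (c.legChart q.1) :=
    F.differentiableAt.mdifferentiableAt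
  have hFq : F (c.legChart q.1) = c.toBase (π.proj q.1.base) := c.fst_eq _ hq
  have hp1 : (fun p : constraintSpace L => π.proj p.1.base) =ᶠ[nhds q]
      c.toBase.symm ∘ (F ∘ fun p : constraintSpace L => c.legChart p.1) := by
    filter_upwards [hnear] with p hp using (FibredChart.toBase_eq hp).symm
  have hp2 : F ∘ (fun p : constraintSpace L => c.legChart p.1) =ᶠ[nhds q]
      c.toBase ∘ fun p : constraintSpace L => π.proj p.1.base := by
    filter_upwards [hnear] with p hp using c.fst_eq _ hp
  have hFl : MDifferentiableAt 𝓘(ℝ, Fin k → ℝ) 𝓘(ℝ, EX n)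
      (F ∘ fun p : constraintSpace L => c.legChart p.1) q :=
    MDifferentiableAt.comp (g := F) (f := fun p : constraintSpace L => c.legChart p.1) q
      hF hmlv
  have hpd : MDifferentiableAt 𝓘(ℝ, Fin k → ℝ) 𝓘(ℝ, EX n)
      (fun p : constraintSpace L => π.proj p.1.base) q := by
    have h0 : MDifferentiableAt 𝓘(ℝ, EX n) 𝓘(ℝ, EX n) c.toBase.symm
        ((F ∘ fun p : constraintSpace L => c.legChart p.1) q) := by
      rw [comp_apply, hFq]
      exact c.base_smooth.mdiff_symm (c.toBase.map_source (c.mapsTo _ hq))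
    exact (h0.comp q hFl).congr_of_eventuallyEq hp1
  have h1 := tmap_congr (E := Fin k → ℝ) (E' := EX n) hp2
  rw [tmap_comp (f := fun p : constraintSpace L => c.legChart p.1) hF hmlv,
    tmap_comp (f := fun p : constraintSpace L => π.proj p.1.base)
      (c.base_smooth.mdiff (c.mapsTo _ hq)) hpd, tmap_eq_fderiv, F.fderiv] at h1
  have h2 := congrArg (fun f => f u) h1
  exact h2.trans ((congrArg (tmap (EX n) (EX n) c.toBase _) hu).trans (map_zero _))

end Constrained

/-! ### Coordinate expression of a solution -/

section Solution
variable {n m : ℕ} {X : Type v} [TopologicalSpace X] [ChartedSpace (EX n) X]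
  {Y : Type u} [TopologicalSpace Y] [ChartedSpace (EY n m) Y] {π : FieldBundle n m X Y}
  [IsManifold 𝓘(ℝ, EX n) ∞ X]

theorem HamiltonianForm.IsSolution.differentiableAt_coord
    {H : HamiltonianForm π} {U : Set X} {r : X → Legendre π}
    (hr : H.IsSolution U r) (hU : IsOpen U) {x : X} (hx : x ∈ U) (c : FibredChart π)
    (hqr : (r x).base ∈ c.toTotal.source) :
    DifferentiableAt ℝ (fun ξ => c.legChart (r (c.toBase.symm ξ))) (c.toBase x) := by
  have hx0 : x ∈ c.toBase.source := by
    rw [← hr.isSection x hx]; exact c.mapsTo _ hqr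
  rw [← mdifferentiableAt_iff_differentiableAt]
  have h1 := c.base_smooth.mdiff_symm (c.toBase.map_source hx0)
  have h2 : MDifferentiableAt 𝓘(ℝ, EX n) 𝓘(ℝ, EP n m) r (c.toBase.symm (c.toBase x)) := by
    rw [c.toBase.left_inv hx0]
    exact (hr.smooth.contMDiffAt (hU.mem_nhds hx)).mdifferentiableAt (by simp)
  have h3 : MDifferentiableAt 𝓘(ℝ, EP n m) 𝓘(ℝ, EP n m) c.legChart
      (r (c.toBase.symm (c.toBase x))) := by
    rw [c.toBase.left_inv hx0]
    exact (c.contMDiffOn_legChart.contMDiffAt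
      (c.isOpen_legSource.mem_nhds hqr)).mdifferentiableAt (by simp)
  exact h3.comp (c.toBase x) (h2.comp (c.toBase x) h1)

/-- In coordinates a section reads `x ↦ (x, y(x), p(x))`. -/
theorem HamiltonianForm.IsSolution.fst_fderiv_coord
    {H : HamiltonianForm π} {U : Set X} {r : X → Legendre π}
    (hr : H.IsSolution U r) (hU : IsOpen U) {x : X} (hx : x ∈ U) (c : FibredChart π)
    (hqr : (r x).base ∈ c.toTotal.source) (v : EX n) :
    (fderiv ℝ (fun ξ => c.legChart (r (c.toBase.symm ξ))) (c.toBase x) v).1.1 = v := by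
  have hx0 : x ∈ c.toBase.source := by
    rw [← hr.isSection x hx]; exact c.mapsTo _ hqr
  have hrU : ∀ᶠ ξ in nhds (c.toBase x), ξ ∈ c.toBase.target ∧ c.toBase.symm ξ ∈ U ∧
      (r (c.toBase.symm ξ)).base ∈ c.toTotal.source := by
    have h1 : Filter.Tendsto c.toBase.symm (nhds (c.toBase x)) (nhds x) := by
      have := c.toBase.continuousAt_symm (c.toBase.map_source hx0)
      rwa [ContinuousAt, c.toBase.left_inv hx0] at this
    have h2 : ContinuousAt r x := (hr.smooth.contMDiffAt (hU.mem_nhds hx)).continuousAt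
    exact (c.toBase.open_target.eventually_mem (c.toBase.map_source hx0)).and
      ((h1.eventually (hU.eventually_mem hx)).and
        (h1.eventually (h2.eventually (c.isOpen_legSource.eventually_mem hqr))))
  have h1 : (fun ξ => (c.legChart (r (c.toBase.symm ξ))).1.1) =ᶠ[nhds (c.toBase x)] id := by
    filter_upwards [hrU] with ξ hξ
    change (c.toTotal (r (c.toBase.symm ξ)).base).1 = ξ
    rw [c.fst_eq _ hξ.2.2, hr.isSection _ hξ.2.1, c.toBase.right_inv hξ.1]
  have h2 := ((hr.differentiableAt_coord hU hx c hqr).hasFDerivAt.fst.fst).fderiv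
  rw [h1.fderiv_eq, fderiv_id] at h2
  exact (congrArg (fun f => f v) h2).symm

end Solution

end CovHam
end

theorem mainTheorem3 {n m k : ℕ}
    {X : Type*} [TopologicalSpace X] [ChartedSpace (EX n) X] [IsManifold 𝓘(ℝ, EX n) ∞ X]
    [T2Space X] [SecondCountableTopology X] [ConnectedSpace X]
    {Y : Type*} [TopologicalSpace Y] [ChartedSpace (EY n m) Y] [IsManifold 𝓘(ℝ, EY n m) ∞ Y]
    [T2Space Y] [SecondCountableTopology Y] [ConnectedSpace Y]
    (π : FieldBundle n m X Y) (L : Lagrangian π)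
    [ChartedSpace (Fin k → ℝ) (constraintSpace L)]
    [IsManifold 𝓘(ℝ, Fin k → ℝ) ∞ (constraintSpace L)]
    (hL : IsAlmostRegular k L)
    (Ψ : constraintSpace L → Jet π) (hΨ : IsLegendreSection k L Ψ)
    (H : HamiltonianForm π) (hH : H.IsAssociated L)
    (U : Set X) (hU : IsOpen U)
    (r : X → Legendre π) (hr : H.IsSolution U r) (hrN : ∀ x ∈ U, r x ∈ constraintSpace L)
    (s : X → constraintSpace L) (hs : ∀ x ∈ U, (s x : Legendre π) = r x) :
    IsConstrainedSolution k L Ψ U s := by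
  have hval := hL.imbedded.contMDiff
  have hrs : ∀ x ∈ U, (Subtype.val ∘ s) =ᶠ[nhds x] r := fun x hx => by
    filter_upwards [hU.mem_nhds hx] with x' hx' using hs x' hx'
  have hsm : ∀ x ∈ U, ContMDiffAt 𝓘(ℝ, EX n) 𝓘(ℝ, Fin k → ℝ) ∞ s x := by
    intro x hx
    have h1 : ContMDiffAt 𝓘(ℝ, EX n) 𝓘(ℝ, EP n m) ∞ (Subtype.val ∘ s) x :=
      (hr.smooth.contMDiffAt (hU.mem_nhds hx)).congr_of_eventuallyEq (hrs x hx)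
    -- `N_L` is an imbedded submanifold, so smoothness into `N_L` is smoothness into `Π`
    rw [ContMDiffAt.iff_comp_isImmersionAt (hL.imbedded.isImmersion.isImmersionAt (s x))]
    exact ⟨hL.imbedded.isEmbedding.continuousAt_iff.2 h1.continuousAt, h1⟩
  refine ⟨fun x hx => (hsm x hx).contMDiffWithinAt, fun x hx => ?_, fun u _ hu x hx w => ?_⟩
  · rw [hs x hx]; exact hr.isSection x hx
  let c := fibredChartAt π (s x).1.base
  have hq : (s x).1.base ∈ c.toTotal.source := mem_fibredChartAt π _
  have hqr : (r x).base ∈ c.toTotal.source := by rw [← hs x hx]; exact hq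
  have hx0 : x ∈ c.toBase.source := by
    rw [← hr.isSection x hx]; exact c.mapsTo _ hqr
  have hms := (hsm x hx).mdifferentiableAt (by simp)
  have hmlv := (contMDiffAt_legChart_val hval c hq).mdifferentiableAt (by simp)
  -- the coordinate expression of the section `r` and its tangent map `A`
  set A : EX n →L[ℝ] EP n m := fderiv ℝ (fun ξ => c.legChart (r (c.toBase.symm ξ))) (c.toBase x)
    with hAdef
  have hRdiff := hr.differentiableAt_coord hU hx c hqr
  have hA := hr.fst_fderiv_coord hU hx c hqr
  have hAs : ∀ v, tmap (Fin k → ℝ) (EP n m) (fun p : constraintSpace L => c.legChart p.1) (s x)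
      (tmap (EX n) (Fin k → ℝ) s x v) = A (tmap (EX n) (EX n) c.toBase x v) := by
    intro v
    have h1 : tmap (EX n) (EP n m) ((fun p : constraintSpace L => c.legChart p.1) ∘ s) x
        = A.comp (tmap (EX n) (EX n) c.toBase x) := by
      rw [hAdef, ← tmap_eq_fderiv, ← tmap_comp hRdiff.mdifferentiableAt (c.base_smooth.mdiff hx0)]
      refine tmap_congr ?_
      filter_upwards [hU.mem_nhds hx, c.toBase.open_source.mem_nhds hx0] with x' hx' hx0'
      simp only [comp_apply]
      rw [hs x' hx', c.toBase.left_inv hx0']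
    rw [tmap_comp hmlv hms] at h1
    exact congrArg (fun f => f v) h1
  have hv := fst_tmap_legChart hval c hq (hu (s x))
  rw [d_constrainedForm hL hΨ hH c hq]
  have hy := hr.eq_y c x hx hqr
  have hp := hr.eq_p c x hx hqr
  have hmain := extDeriv_coordDForm_eq_zero (H.differentiableAt_ham c hqr) A hA hy hp hv
    fun i => tmap (EX n) (EX n) c.toBase x (w i)
  refine Eq.trans ?_ hmain
  rw [← hs x hx, ContinuousAlternatingMap.compContinuousLinearMap_apply]
  congr 1
  funext i
  refine Fin.cases rfl (fun i => ?_) i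
  exact hAs (w i)
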